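/- Let $p\ge 0$ and $m\ge 1$ be integers, $\alpha_0>0$, and $\beta=(\beta_0,\beta_1^{\mathsf T})^{\mathsf T}\in\mathbb R^{p+1}$. Let $(Y_j,Z_j,S_j)$, $j=1,2,\dots$, be independent and identically distributed, where $Y_j$ is a random vector in $\mathbb R^p$ with finite second moments and positive definite covariance matrix, $Z_j=(Z_{j1},Z_{j2})^{\mathsf T}$ is the indicator vector of the ground-truth class of the $j$th observation, and $S_j=(S_{j1},S_{j2})^{\mathsf T}$ is a vector of vote counts. Put $$\tau_1(y;\beta)=\frac{\exp(\beta_0+\beta_1^{\mathsf T}y)}{1+\exp(\beta_0+\beta_1^{\mathsf T}y)},\qquad \tau_2(y;\beta)=1-\tau_1(y;\beta),\qquad \tau=(\tau_1,\tau_2)^{\mathsf T}.$$ Suppose that $\mathrm{pr}(Z_{ji}=1\mid Y_j)=\tau_i(Y_j;\beta)$ for $i=1,2$, and that, conditionally on $Y_j$, $S_j$ has the Dirichlet--Multinomial$(m,\alpha_0\tau(Y_j;\beta))$ distribution, where for $a\in(0,\infty)^2$ the Dirichlet--Multinomial$(m,a)$ distribution gives mass $$\frac{m!\,\Gamma(a_1+a_2)}{\Gamma(m+a_1+a_2)}\prod_{i=1}^{2}\frac{\Gamma(s_i+a_i)}{s_i!\,\Gamma(a_i)}$$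 to each $(s_1,s_2)$ with nonnegative integer entries and $s_1+s_2=m$. For $b=(b_0,b_1^{\mathsf T})^{\mathsf T}\in\mathbb R^{p+1}$, define the logistic log-likelihoods of a single observation by $$\ell(b;z,y)=z_1(b_0+b_1^{\mathsf T}y)-\log\{1+\exp(b_0+b_1^{\mathsf T}y)\},\qquad \ell_m(b;s,y)=s_1(b_0+b_1^{\mathsf T}y)-m\log\{1+\exp(b_0+b_1^{\mathsf T}y)\},$$ and the matrices $$I_{LR}=\mathrm{cov}\{\nabla_b\,\ell(\beta;Z_1,Y_1)\},\quad H=-\mathbb E\{\nabla_b^2\,\ell_m(\beta;S_1,Y_1)\},\quad G=\mathrm{cov}\{\nabla_b\,\ell_m(\beta;S_1,Y_1)\},\quad I_M=HG^{-1}H,$$ so that $I_{LR}$ is the Fisher information from the ground-truth labels and $I_M$ is the Godambe (sandwich) information of the misspecified logistic likelihood of the vote counts. For each $n$, let $\widehat\beta_M=\widehat\beta_{M,n}$ be a random vector in $\mathbb R^{p+1}$ that almost surely maximises $b\mapsto\sum_{j=1}^n\ell_m(b;S_j,Y_j)$ over $\mathbb R^{p+1}$ whenever a maximiser exists (and is arbitrary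 otherwise). Then, as $n\to\infty$, a maximiser exists with probability tending to one; $\widehat\beta_M$ is a consistent estimator of $\beta$, that is, $\widehat\beta_M\to\beta$ in probability; the moments that define $I_{LR}$, $H$ and $G$ exist and $I_{LR}$ and $G$ are positive definite; $$\sqrt n\,(\widehat\beta_M-\beta)\to N(0,I_M^{-1})\quad\text{in distribution};\qquad\text{and}\qquad I_M=\frac{m(1+\alpha_0)}{m+\alpha_0}\,I_{LR}.$$ -/

import Mathlib

open MeasureTheory ProbabilityTheory Filter Topology
open scoped Nat

noncomputable section

namespace NoisyLabels

/-- The linear predictor `β₀ + β₁ᵀ y`; coordinate `0` of `b` is the intercept `β₀` and the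
remaining coordinates form `β₁`. -/
def linPred {p : ℕ} (b : EuclideanSpace ℝ (Fin (p + 1))) (y : EuclideanSpace ℝ (Fin p)) : ℝ :=
  b 0 + ∑ i : Fin p, b i.succ * y i

/-- Class probabilities `τ(y; β)` of binary logistic regression. Index `0 : Fin 2` is the first
class, index `1 : Fin 2` the second one. -/
def classProb {p : ℕ} (b : EuclideanSpace ℝ (Fin (p + 1))) (y : EuclideanSpace ℝ (Fin p)) :
    Fin 2 → ℝ :=
  ![Real.exp (linPred b y) / (1 + Real.exp (linPred b y)),
    1 - Real.exp (linPred b y) / (1 + Real.exp (linPred b y))]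

/-- Probability mass function of the Dirichlet-Multinomial distribution with `m` trials and
parameter vector `a` (all `a i > 0`) on the count vectors with total `m`:
`m! Γ(∑ a) / Γ(m + ∑ a) * ∏ i, Γ(s i + a i) / ((s i)! Γ(a i))`. -/
def dirichletMultinomialPMF {g : ℕ} (m : ℕ) (a : Fin g → ℝ) (s : Fin g → ℕ) : ℝ :=
  if ∑ i, s i = m then
    ((m ! : ℕ) : ℝ) * Real.Gamma (∑ i, a i) / Real.Gamma (m + ∑ i, a i) *
      ∏ i, Real.Gamma (s i + a i) / (((s i)! : ℕ) * Real.Gamma (a i))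
  else 0

/-- The covariance matrix of a random vector. -/
def covMatrix {Ω : Type*} [MeasurableSpace Ω] {d : ℕ} (μ : Measure Ω)
    (X : Ω → EuclideanSpace ℝ (Fin d)) : Matrix (Fin d) (Fin d) ℝ :=
  Matrix.of fun i k => covariance (fun ω => X ω i) (fun ω => X ω k) μ

/-- The Hessian matrix of `f` at `b`. -/
def hessian {d : ℕ} (f : EuclideanSpace ℝ (Fin d) → ℝ) (b : EuclideanSpace ℝ (Fin d)) :
    Matrix (Fin d) (Fin d) ℝ :=
  Matrix.of fun i k => fderiv ℝ (gradient f) b (EuclideanSpace.single k 1) i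

/-- Logistic log-likelihood of one observation with ground-truth label vector `z` (the indicator
vector of the class) and feature vector `y`. -/
def labelLogLik {p : ℕ} (z : Fin 2 → ℕ) (y : EuclideanSpace ℝ (Fin p))
    (b : EuclideanSpace ℝ (Fin (p + 1))) : ℝ :=
  z 0 * linPred b y - Real.log (1 + Real.exp (linPred b y))

/-- Logistic log-likelihood of one observation with vector of vote counts `s` out of `m` votes
and feature vector `y`. -/
def voteLogLik {p : ℕ} (m : ℕ) (s : Fin 2 → ℕ) (y : EuclideanSpace ℝ (Fin p))
    (b : EuclideanSpace ℝ (Fin (p + 1))) : ℝ :=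
  s 0 * linPred b y - m * Real.log (1 + Real.exp (linPred b y))

/-- Logistic log-likelihood of the vote counts of the first `n` observations. -/
def sampleVoteLogLik {p : ℕ} (m n : ℕ) (s : ℕ → Fin 2 → ℕ) (y : ℕ → EuclideanSpace ℝ (Fin p))
    (b : EuclideanSpace ℝ (Fin (p + 1))) : ℝ :=
  ∑ j ∈ Finset.range n, voteLogLik m (s j) (y j) b

/-- `b` maximises the logistic log-likelihood of the vote counts of the first `n` observations. -/
def IsVoteMaximiser {p : ℕ} (m n : ℕ) (s : ℕ → Fin 2 → ℕ) (y : ℕ → EuclideanSpace ℝ (Fin p))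
    (b : EuclideanSpace ℝ (Fin (p + 1))) : Prop :=
  ∀ b', sampleVoteLogLik m n s y b' ≤ sampleVoteLogLik m n s y b

section Information

variable {Ω : Type*} [MeasurableSpace Ω] {p : ℕ}

/-- Score vector at `β` of one observation with ground-truth label. -/
def labelScore (Y : Ω → EuclideanSpace ℝ (Fin p)) (Z : Ω → Fin 2 → ℕ)
    (β : EuclideanSpace ℝ (Fin (p + 1))) (ω : Ω) : EuclideanSpace ℝ (Fin (p + 1)) :=
  gradient (labelLogLik (Z ω) (Y ω)) β

/-- Score vector at `β` of one observation with vote counts. -/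
def voteScore (m : ℕ) (Y : Ω → EuclideanSpace ℝ (Fin p)) (S : Ω → Fin 2 → ℕ)
    (β : EuclideanSpace ℝ (Fin (p + 1))) (ω : Ω) : EuclideanSpace ℝ (Fin (p + 1)) :=
  gradient (voteLogLik m (S ω) (Y ω)) β

/-- Fisher information `I_LR` about `β` in one observation with ground-truth label: the
covariance matrix of the score. -/
def fisherInfo (μ : Measure Ω) (Y : Ω → EuclideanSpace ℝ (Fin p)) (Z : Ω → Fin 2 → ℕ)
    (β : EuclideanSpace ℝ (Fin (p + 1))) : Matrix (Fin (p + 1)) (Fin (p + 1)) ℝ :=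
  covMatrix μ (labelScore Y Z β)

/-- `H`: minus the expected Hessian of the vote log-likelihood of one observation. -/
def sensitivity (μ : Measure Ω) (m : ℕ) (Y : Ω → EuclideanSpace ℝ (Fin p)) (S : Ω → Fin 2 → ℕ)
    (β : EuclideanSpace ℝ (Fin (p + 1))) : Matrix (Fin (p + 1)) (Fin (p + 1)) ℝ :=
  Matrix.of fun i k => -∫ ω, hessian (voteLogLik m (S ω) (Y ω)) β i k ∂μ

/-- `G`: the covariance matrix of the score of the vote log-likelihood of one observation. -/
def variability (μ : Measure Ω) (m : ℕ) (Y : Ω → EuclideanSpace ℝ (Fin p)) (S : Ω → Fin 2 → ℕ)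
    (β : EuclideanSpace ℝ (Fin (p + 1))) : Matrix (Fin (p + 1)) (Fin (p + 1)) ℝ :=
  covMatrix μ (voteScore m Y S β)

/-- Godambe (sandwich) information `I_M = H G⁻¹ H`. -/
def godambeInfo (μ : Measure Ω) (m : ℕ) (Y : Ω → EuclideanSpace ℝ (Fin p)) (S : Ω → Fin 2 → ℕ)
    (β : EuclideanSpace ℝ (Fin (p + 1))) : Matrix (Fin (p + 1)) (Fin (p + 1)) ℝ :=
  sensitivity μ m Y S β * (variability μ m Y S β)⁻¹ * sensitivity μ m Y S β

/-- The data-generating model: i.i.d. triples (features, label vector, vote counts), features with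
positive definite covariance matrix, labels given the features from the logistic regression model
with parameter `β`, and vote counts given the features from the
Dirichlet-Multinomial`(m, α₀ τ(y; β))` distribution. -/
structure IsNoisyLabelModel (μ : Measure Ω) (m : ℕ) (α₀ : ℝ) (β : EuclideanSpace ℝ (Fin (p + 1)))
    (Y : ℕ → Ω → EuclideanSpace ℝ (Fin p)) (Z S : ℕ → Ω → Fin 2 → ℕ) : Prop where
  measurable_Y : ∀ j, Measurable (Y j)
  measurable_Z : ∀ j, Measurable (Z j)
  measurable_S : ∀ j, Measurable (S j)
  indep : iIndepFun (fun j ω => (Y j ω, Z j ω, S j ω)) μ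
  identDistrib : ∀ j, IdentDistrib (fun ω => (Y j ω, Z j ω, S j ω))
    (fun ω => (Y 0 ω, Z 0 ω, S 0 ω)) μ μ
  memLp_Y : ∀ j, MemLp (Y j) 2 μ
  posDef_cov : ∀ j, (covMatrix μ (Y j)).PosDef
  /-- `P(Z_{ji} = 1 | Y_j) = τ_i(Y_j; β)`, where `Z_j` is the unit vector of its class. -/
  label_law : ∀ j (i : Fin 2),
    μ⟦Z j ⁻¹' {Pi.single i 1} | MeasurableSpace.comap (Y j) inferInstance⟧
      =ᵐ[μ] fun ω => classProb β (Y j ω) i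
  /-- `P(S_j = s | Y_j)` is the Dirichlet-Multinomial probability of `s`. -/
  vote_law : ∀ j (s : Fin 2 → ℕ),
    μ⟦S j ⁻¹' {s} | MeasurableSpace.comap (Y j) inferInstance⟧
      =ᵐ[μ] fun ω => dirichletMultinomialPMF m (fun i => α₀ * classProb β (Y j ω) i) s

end Information

end NoisyLabels

end

open scoped RealInnerProductSpace ENNReal

noncomputable section

namespace NoisyLabels

/-! ### The softplus function -/

/-- The derivative of the logistic sigmoid. -/
def sigmoidSlope (t : ℝ) : ℝ := Real.sigmoid t * (1 - Real.sigmoid t)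

lemma sigmoidSlope_pos (t : ℝ) : 0 < sigmoidSlope t :=
  mul_pos (Real.sigmoid_pos t) (sub_pos.2 (Real.sigmoid_lt_one t))

lemma sigmoidSlope_le_one (t : ℝ) : sigmoidSlope t ≤ 1 := by
  have h0 := Real.sigmoid_pos t
  have h1 := Real.sigmoid_lt_one t
  unfold sigmoidSlope
  nlinarith [mul_pos h0 h0]

lemma hasDerivAt_sigmoid' (t : ℝ) : HasDerivAt Real.sigmoid (sigmoidSlope t) t :=
  Real.hasDerivAt_sigmoid t

lemma exp_div_one_add_exp (t : ℝ) : Real.exp t / (1 + Real.exp t) = Real.sigmoid t := by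
  rw [Real.sigmoid, Real.exp_neg]
  field_simp
  ring

lemma hasDerivAt_softplus (t : ℝ) :
    HasDerivAt (fun t => Real.log (1 + Real.exp t)) (Real.sigmoid t) t := by
  rw [← exp_div_one_add_exp]
  exact ((Real.hasDerivAt_exp t).const_add 1).log (by positivity)

lemma hasDerivAt_sigmoidSlope (t : ℝ) :
    HasDerivAt sigmoidSlope (sigmoidSlope t * (1 - 2 * Real.sigmoid t)) t := by
  have h := (hasDerivAt_sigmoid' t).mul ((hasDerivAt_sigmoid' t).const_sub 1)
  refine h.congr_deriv ?_
  unfold sigmoidSlope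
  ring

lemma continuous_sigmoidSlope : Continuous sigmoidSlope :=
  continuous_iff_continuousAt.2 fun t => (hasDerivAt_sigmoidSlope t).continuousAt

lemma abs_sigmoidSlope_sub_le (a h : ℝ) :
    |sigmoidSlope (a + h) - sigmoidSlope a| ≤ min 1 |h| := by
  refine le_min ?_ ?_
  · have h1 := sigmoidSlope_pos (a + h)
    have h2 := sigmoidSlope_pos a
    have h3 := sigmoidSlope_le_one (a + h)
    have h4 := sigmoidSlope_le_one a
    rw [abs_le]
    constructor <;> linarith
  · have := Convex.norm_image_sub_le_of_norm_hasDerivWithin_le (s := Set.univ) (C := 1)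
      (fun t _ => (hasDerivAt_sigmoidSlope t).hasDerivWithinAt) (fun t _ => ?_) convex_univ
      (Set.mem_univ a) (Set.mem_univ (a + h))
    · simpa using this
    · have h1 := sigmoidSlope_pos t
      have h2 := sigmoidSlope_le_one t
      have h3 := Real.sigmoid_pos t
      have h4 := Real.sigmoid_lt_one t
      rw [Real.norm_eq_abs, abs_le]
      constructor <;> nlinarith

/-- Second order Taylor expansion of the softplus function. -/
lemma abs_softplus_taylor_le (a h : ℝ) :
    |Real.log (1 + Real.exp (a + h)) - Real.log (1 + Real.exp a) - Real.sigmoid a * h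
      - sigmoidSlope a * h ^ 2 / 2| ≤ h ^ 2 * min 1 |h| := by
  set κ := min 1 |h| with hκ
  have hmem : ∀ {t : ℝ}, t ∈ Metric.closedBall (0 : ℝ) |h| → |t| ≤ |h| := by
    intro t ht
    simpa using ht
  have h0 : (0 : ℝ) ∈ Metric.closedBall (0 : ℝ) |h| := by simp
  have hh : h ∈ Metric.closedBall (0 : ℝ) |h| := by simp
  have hκ0 : 0 ≤ κ := by positivity
  have hadd : ∀ t : ℝ, HasDerivAt (fun t => a + t) 1 t := fun t => (hasDerivAt_id t).const_add a
  have d1 : ∀ t, HasDerivAt (fun t => Real.sigmoid (a + t) - Real.sigmoid a - sigmoidSlope a * t)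
      (sigmoidSlope (a + t) - sigmoidSlope a) t := by
    intro t
    have := (((hasDerivAt_sigmoid' (a + t)).comp t (hadd t)).sub_const (Real.sigmoid a)).sub
      ((hasDerivAt_id t).const_mul (sigmoidSlope a))
    exact this.congr_deriv (by simp)
  have d0 : ∀ t, HasDerivAt (fun t => Real.log (1 + Real.exp (a + t)) - Real.log (1 + Real.exp a)
      - Real.sigmoid a * t - sigmoidSlope a * t ^ 2 / 2)
      (Real.sigmoid (a + t) - Real.sigmoid a - sigmoidSlope a * t) t := by
    intro t
    have := ((((hasDerivAt_softplus (a + t)).comp t (hadd t)).sub_const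
      (Real.log (1 + Real.exp a))).sub ((hasDerivAt_id t).const_mul (Real.sigmoid a))).sub
      ((((hasDerivAt_id t).pow 2).const_mul (sigmoidSlope a)).div_const 2)
    refine this.congr_deriv ?_
    simp
    ring
  have b1 : ∀ t ∈ Metric.closedBall (0 : ℝ) |h|,
      ‖Real.sigmoid (a + t) - Real.sigmoid a - sigmoidSlope a * t‖ ≤ κ * |h| := by
    intro t ht
    have := Convex.norm_image_sub_le_of_norm_hasDerivWithin_le (C := κ)
      (fun t _ => (d1 t).hasDerivWithinAt) (fun t ht => ?_) (convex_closedBall (0 : ℝ) |h|) h0 ht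
    · simp only [add_zero, mul_zero, sub_self, sub_zero] at this
      exact this.trans (mul_le_mul_of_nonneg_left (hmem ht) hκ0)
    · exact (abs_sigmoidSlope_sub_le a t).trans (min_le_min_left _ (hmem ht))
  have := Convex.norm_image_sub_le_of_norm_hasDerivWithin_le
      (fun t _ => (d0 t).hasDerivWithinAt) b1 (convex_closedBall (0 : ℝ) |h|) h0 hh
  simp only [add_zero, mul_zero, sub_self, sub_zero, Real.norm_eq_abs] at this
  calc _ ≤ _ := by simpa using this
    _ = h ^ 2 * κ := by rw [← sq_abs h]; ring

lemma convexOn_softplus : ConvexOn ℝ Set.univ (fun t => Real.log (1 + Real.exp t)) := by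
  refine MonotoneOn.convexOn_of_deriv convex_univ ?_ ?_ ?_
  · exact (continuous_iff_continuousAt.2 fun t => (hasDerivAt_softplus t).continuousAt).continuousOn
  · exact fun t _ => (hasDerivAt_softplus t).differentiableAt.differentiableWithinAt
  · have : deriv (fun t => Real.log (1 + Real.exp t)) = Real.sigmoid :=
      funext fun t => (hasDerivAt_softplus t).deriv
    rw [this]
    exact Real.sigmoid_monotone.monotoneOn _

/-! ### Maximisers of concave functions -/

/-- A continuous concave function that is smaller on a sphere than at its centre has a maximiser,
and all its maximisers lie in the closed ball. -/
lemma exists_forall_le_of_lt_on_sphere {E : Type*} [NormedAddCommGroup E] [NormedSpace ℝ E]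
    [ProperSpace E] {f : E → ℝ} (hf : ConcaveOn ℝ Set.univ f) (hc : Continuous f)
    {c : E} {δ : ℝ} (hδ : 0 < δ) (hlt : ∀ u, ‖u - c‖ = δ → f u < f c) :
    (∃ u, ∀ v, f v ≤ f u) ∧ ∀ u, (∀ v, f v ≤ f u) → ‖u - c‖ ≤ δ := by
  have hout : ∀ u, δ < ‖u - c‖ → f u < f c := by
    intro u hu
    by_contra! hle
    have hpos : 0 < ‖u - c‖ := hδ.trans hu
    set t := δ / ‖u - c‖ with ht
    have ht0 : 0 ≤ t := by positivity
    have ht1 : t ≤ 1 := (div_le_one hpos).2 hu.le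
    have hcomb := hf.2 (Set.mem_univ c) (Set.mem_univ u) (sub_nonneg.2 ht1) ht0 (by ring)
    have hsub : (1 - t) • c + t • u - c = t • (u - c) := by module
    have hn : ‖(1 - t) • c + t • u - c‖ = δ := by
      rw [hsub, norm_smul, Real.norm_of_nonneg ht0, ht]
      field_simp
    have := hlt _ hn
    simp only [smul_eq_mul] at hcomb
    nlinarith
  refine ⟨?_, fun u hu => ?_⟩
  · obtain ⟨u, -, hu⟩ := (isCompact_closedBall c δ).exists_isMaxOn
      ⟨c, Metric.mem_closedBall_self hδ.le⟩ hc.continuousOn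
    refine ⟨u, fun v => ?_⟩
    by_cases hv : ‖v - c‖ ≤ δ
    · exact hu (by simpa [dist_eq_norm] using hv)
    · exact (hout v (not_le.1 hv)).le.trans (hu (Metric.mem_closedBall_self hδ.le))
  · by_contra! h
    exact absurd (hu c) (not_le.2 (hout u h))

/-! ### Central limit theorem for random vectors -/

/-- Central limit theorem for centred square integrable i.i.d. random vectors. -/
theorem tendstoInDistribution_inv_sqrt_smul_sum {Ω ι : Type*} [MeasurableSpace Ω] [Fintype ι]
    [DecidableEq ι] {μ : Measure Ω} [IsProbabilityMeasure μ] {X : ℕ → Ω → EuclideanSpace ℝ ι}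
    (hX : MemLp (X 0) 2 μ) (hmean : ∫ ω, X 0 ω ∂μ = 0) (hindep : iIndepFun X μ)
    (hident : ∀ i, IdentDistrib (X i) (X 0) μ μ) {V : Matrix ι ι ℝ} (hV : V.PosSemidef)
    (hvar : ∀ t : EuclideanSpace ℝ ι, Var[fun ω => ⟪X 0 ω, t⟫; μ] = t ⬝ᵥ V.mulVec t) :
    TendstoInDistribution (fun (n : ℕ) ω => (√(n : ℝ))⁻¹ • ∑ k ∈ Finset.range n, X k ω) atTop id
      (fun _ => μ) (multivariateGaussian 0 V) where
  forall_aemeasurable n :=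
    (Finset.aemeasurable_fun_sum _ fun k _ => (hident k).aemeasurable_fst).fun_const_smul _
  tendsto := by
    have mX i := (hident i).aemeasurable_fst
    refine ProbabilityMeasure.tendsto_iff_tendsto_charFun.2 fun t => ?_
    have hmeas : Measurable fun x : EuclideanSpace ℝ ι => ⟪x, t⟫ := by fun_prop
    have hone := tendstoInDistribution_inv_sqrt_mul_sum_sub (P := μ) (P' := gaussianReal 0
      Var[fun ω => ⟪X 0 ω, t⟫; μ].toNNReal) (Y := id) (X := fun i ω => ⟪X i ω, t⟫)
      ⟨aemeasurable_id, Measure.map_id⟩ (hX.inner_const t)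
      (hindep.comp (fun _ x => ⟪x, t⟫) fun _ => hmeas) (fun i => (hident i).comp hmeas)
    have hone' := ProbabilityMeasure.tendsto_iff_tendsto_charFun.1 hone.tendsto 1
    have h_int : ∫ ω, ⟪X 0 ω, t⟫ ∂μ = 0 := by
      simp_rw [real_inner_comm]
      rw [integral_inner (hX.integrable (by norm_num)), hmean, inner_zero_right]
    have hnn : 0 ≤ t ⬝ᵥ V.mulVec t := hvar t ▸ variance_nonneg _ _
    simp only [ProbabilityMeasure.coe_mk, Measure.map_id, charFun_gaussianReal, hvar, h_int,
      Real.coe_toNNReal _ hnn, mul_zero, sub_zero] at hone' ⊢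
    rw [charFun_multivariateGaussian hV]
    convert hone' using 2
    · rename_i n
      rw [charFun_apply, charFun_apply, integral_map, integral_map]
      · refine integral_congr_ae (ae_of_all _ fun ω => ?_)
        simp [real_inner_smul_left, sum_inner]
      · exact (Finset.aemeasurable_fun_sum _ fun i _ => hmeas.comp_aemeasurable (mX i)).const_mul _
      · exact (by fun_prop : Continuous fun x : ℝ =>
          Complex.exp (⟪x, 1⟫ * Complex.I)).aestronglyMeasurable
      · exact (Finset.aemeasurable_fun_sum _ fun i _ => mX i).fun_const_smul _
      · exact (by fun_prop : Continuous fun x : EuclideanSpace ℝ ι =>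
          Complex.exp (⟪x, t⟫ * Complex.I)).aestronglyMeasurable
    · simp

/-! ### The logistic objective function -/

section Objective

variable {E : Type*} [NormedAddCommGroup E] [InnerProductSpace ℝ E]

/-- Log-likelihood of logistic regression with responses `s j`, numbers of trials `m` and
regressors `x j`. -/
def logisticObjective (m : ℝ) (n : ℕ) (s : ℕ → ℝ) (x : ℕ → E) (b : E) : ℝ :=
  ∑ j ∈ Finset.range n, (s j * ⟪x j, b⟫ - m * Real.log (1 + Real.exp ⟪x j, b⟫))

/-- Average over `j < n` of `‖x j‖² min(1, ρ ‖x j‖ / √n)`, which bounds the remainder of the second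
order expansion of the logistic objective function. -/
def taylorRemainder (ρ : ℝ) (n : ℕ) (x : ℕ → E) : ℝ :=
  (n : ℝ)⁻¹ * ∑ j ∈ Finset.range n, ‖x j‖ ^ 2 * min 1 (ρ * ‖x j‖ * (√(n : ℝ))⁻¹)

lemma continuous_logisticObjective (m : ℝ) (n : ℕ) (s : ℕ → ℝ) (x : ℕ → E) :
    Continuous (logisticObjective m n s x) := by
  refine continuous_finsetSum _ fun j _ => ?_
  have hne : ∀ b : E, 1 + Real.exp ⟪x j, b⟫ ≠ 0 := fun b => by positivity
  fun_prop (disch := assumption)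

lemma concaveOn_logisticObjective {m : ℝ} (hm : 0 ≤ m) (n : ℕ) (s : ℕ → ℝ) (x : ℕ → E) :
    ConcaveOn ℝ Set.univ (logisticObjective m n s x) := by
  refine ⟨convex_univ, fun b _ b' _ t t' ht ht' htt => ?_⟩
  simp only [logisticObjective, smul_eq_mul, Finset.mul_sum, ← Finset.sum_add_distrib]
  refine Finset.sum_le_sum fun j _ => ?_
  have h := convexOn_softplus.2 (Set.mem_univ ⟪x j, b⟫) (Set.mem_univ ⟪x j, b'⟫) ht ht' htt
  simp only [smul_eq_mul] at h
  simp only [inner_add_right, real_inner_smul_right]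
  nlinarith

/-- Second order expansion of the logistic objective function around `β`. -/
lemma abs_logisticObjective_expansion_le {m : ℝ} (hm : 0 ≤ m) {n : ℕ} (hn : 0 < n) (s : ℕ → ℝ)
    (x : ℕ → E) (β : E) {ρ : ℝ} {u : E} (hu : ‖u‖ ≤ ρ) :
    |logisticObjective m n s x (β + (√(n : ℝ))⁻¹ • u) - logisticObjective m n s x β -
      (⟪(√(n : ℝ))⁻¹ • ∑ j ∈ Finset.range n, (s j - m * Real.sigmoid ⟪x j, β⟫) • x j, u⟫ -
        m / 2 * ((n : ℝ)⁻¹ * ∑ j ∈ Finset.range n, sigmoidSlope ⟪x j, β⟫ * ⟪x j, u⟫ ^ 2))|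
      ≤ m * ρ ^ 2 * taylorRemainder ρ n x := by
  have hn' : (0 : ℝ) < n := by exact_mod_cast hn
  have hρ : 0 ≤ ρ := (norm_nonneg u).trans hu
  set r := (√(n : ℝ))⁻¹ with hr
  have hr0 : 0 ≤ r := by positivity
  have hr2 : r ^ 2 = (n : ℝ)⁻¹ := by rw [hr, inv_pow, Real.sq_sqrt hn'.le]
  simp only [logisticObjective, taylorRemainder, real_inner_smul_left, sum_inner,
    Finset.mul_sum, ← Finset.sum_sub_distrib, ← hr2, ← hr]
  refine (Finset.abs_sum_le_sum_abs _ _).trans (Finset.sum_le_sum fun j _ => ?_)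
  have key := abs_softplus_taylor_le ⟪x j, β⟫ (r * ⟪x j, u⟫)
  have hin : |r * ⟪x j, u⟫| ≤ r * (ρ * ‖x j‖) := by
    rw [abs_mul, abs_of_nonneg hr0]
    refine mul_le_mul_of_nonneg_left ?_ hr0
    rw [mul_comm ρ]
    exact (abs_real_inner_le_norm _ _).trans (mul_le_mul_of_nonneg_left hu (norm_nonneg _))
  have hsq : (r * ⟪x j, u⟫) ^ 2 ≤ (r * (ρ * ‖x j‖)) ^ 2 := by
    rw [← sq_abs]
    exact pow_le_pow_left₀ (abs_nonneg _) hin 2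
  have hmin : min 1 |r * ⟪x j, u⟫| ≤ min 1 (ρ * ‖x j‖ * r) :=
    min_le_min_left _ (hin.trans_eq (by ring))
  rw [inner_add_right, real_inner_smul_right]
  calc _ = |-(m * (Real.log (1 + Real.exp (⟪x j, β⟫ + r * ⟪x j, u⟫)) -
          Real.log (1 + Real.exp ⟪x j, β⟫) - Real.sigmoid ⟪x j, β⟫ * (r * ⟪x j, u⟫) -
          sigmoidSlope ⟪x j, β⟫ * (r * ⟪x j, u⟫) ^ 2 / 2))| := by congr 1; ring
    _ ≤ m * ((r * ⟪x j, u⟫) ^ 2 * min 1 |r * ⟪x j, u⟫|) := by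
      rw [abs_neg, abs_mul, abs_of_nonneg hm]
      exact mul_le_mul_of_nonneg_left key hm
    _ ≤ m * ((r * (ρ * ‖x j‖)) ^ 2 * min 1 (ρ * ‖x j‖ * r)) := by
      refine mul_le_mul_of_nonneg_left (mul_le_mul hsq hmin ?_ (sq_nonneg _)) hm
      positivity
    _ = _ := by ring

/-- If the rescaled logistic objective function is close to a quadratic function with maximum at
`c`, then it has maximisers, and all of them are close to `c`. -/
lemma exists_isMax_logisticObjective [FiniteDimensional ℝ E] {m : ℝ} (hm : 0 < m) {n : ℕ}
    (hn : 0 < n) (s : ℕ → ℝ) (x : ℕ → E) (β : E) {T : E →L[ℝ] E} (hT : T.IsSymmetric) {l : ℝ}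
    (hl : ∀ v, l * ‖v‖ ^ 2 ≤ ⟪v, T v⟫) {c : E}
    (hc : m • T c =
      (√(n : ℝ))⁻¹ • ∑ j ∈ Finset.range n, (s j - m * Real.sigmoid ⟪x j, β⟫) • x j)
    {D : ℝ} (hD0 : 0 ≤ D)
    (hD : ∀ u, |(n : ℝ)⁻¹ * ∑ j ∈ Finset.range n, sigmoidSlope ⟪x j, β⟫ * ⟪x j, u⟫ ^ 2
      - ⟪u, T u⟫| ≤ D * ‖u‖ ^ 2) {K δ : ℝ} (hδ : 0 < δ) (hK : ‖c‖ ≤ K)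
    (hsmall : (K + δ) ^ 2 * (2 * taylorRemainder (K + δ) n x + D) < l * δ ^ 2 / 2) :
    (∃ b, ∀ b', logisticObjective m n s x b' ≤ logisticObjective m n s x b) ∧
      ∀ b, (∀ b', logisticObjective m n s x b' ≤ logisticObjective m n s x b) →
        ‖√(n : ℝ) • (b - β) - c‖ ≤ δ := by
  have hn' : (0 : ℝ) < n := by exact_mod_cast hn
  have hs : √(n : ℝ) ≠ 0 := (Real.sqrt_pos.2 hn').ne'
  set f : E → ℝ := fun u => logisticObjective m n s x (β + (√(n : ℝ))⁻¹ • u) with hf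
  have happrox : ∀ u, ‖u‖ ≤ K + δ →
      |f u - logisticObjective m n s x β - (m * ⟪T c, u⟫ - m / 2 * ⟪u, T u⟫)| ≤
        m * (K + δ) ^ 2 * taylorRemainder (K + δ) n x + m / 2 * (D * (K + δ) ^ 2) := by
    intro u hu
    have h1 := abs_logisticObjective_expansion_le hm.le hn s x β hu
    rw [← hc, real_inner_smul_left] at h1
    have h2 := hD u
    have h3 : D * ‖u‖ ^ 2 ≤ D * (K + δ) ^ 2 :=
      mul_le_mul_of_nonneg_left (pow_le_pow_left₀ (norm_nonneg _) hu 2) hD0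
    rw [abs_le] at h1 h2 ⊢
    simp only [hf]
    constructor <;> nlinarith
  have hfc : ConcaveOn ℝ Set.univ f := by
    refine ⟨convex_univ, fun u _ v _ t t' ht ht' htt => ?_⟩
    have := (concaveOn_logisticObjective hm.le n s x).2 (Set.mem_univ (β + (√(n : ℝ))⁻¹ • u))
      (Set.mem_univ (β + (√(n : ℝ))⁻¹ • v)) ht ht' htt
    refine this.trans_eq ?_
    simp only [hf]
    congr 1
    have : β = t • β + t' • β := by rw [← add_smul, htt, one_smul]
    nth_rewrite 3 [this]
    module
  have hcont : Continuous f := (continuous_logisticObjective m n s x).comp (by fun_prop)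
  have hlt : ∀ u, ‖u - c‖ = δ → f u < f c := by
    intro u hu
    have huK : ‖u‖ ≤ K + δ := by
      calc ‖u‖ = ‖c + (u - c)‖ := by congr 1; abel
        _ ≤ K + δ := (norm_add_le _ _).trans (add_le_add hK hu.le)
    have h1 := happrox u huK
    have h2 := happrox c (hK.trans (by linarith))
    have h3 := hl (u - c)
    rw [hu] at h3
    have h4 : ⟪u - c, T (u - c)⟫ = ⟪u, T u⟫ - 2 * ⟪T c, u⟫ + ⟪c, T c⟫ := by
      have h5 : ⟪c, T u⟫ = ⟪T c, u⟫ := (hT c u).symm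
      rw [map_sub, inner_sub_left, inner_sub_right, inner_sub_right, h5, real_inner_comm u (T c)]
      ring
    have h6 : ⟪T c, c⟫ = ⟪c, T c⟫ := real_inner_comm _ _
    rw [h4] at h3
    rw [abs_le] at h1 h2
    rw [h6] at h2
    have h7 := mul_lt_mul_of_pos_left hsmall hm
    have h8 := mul_le_mul_of_nonneg_left h3 hm.le
    linarith [h1.2, h2.1]
  obtain ⟨⟨u, hu⟩, hall⟩ := exists_forall_le_of_lt_on_sphere hfc hcont hδ hlt
  have hinv : ∀ b : E, f (√(n : ℝ) • (b - β)) = logisticObjective m n s x b := by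
    intro b
    simp only [hf, smul_smul, inv_mul_cancel₀ hs, one_smul, add_sub_cancel]
  refine ⟨⟨β + (√(n : ℝ))⁻¹ • u, fun b' => ?_⟩, fun b hb => hall _ fun v => ?_⟩
  · rw [← hinv b']
    exact hu _
  · rw [hinv b]
    exact hb _

end Objective

/-! ### Convergence in distribution and boundedness in probability -/

section Tight

variable {Ω Ω' E : Type*} [MeasurableSpace Ω] [MeasurableSpace Ω'] {μ : Measure Ω}
  {ν : Measure Ω'} [IsProbabilityMeasure μ] [IsProbabilityMeasure ν]
  [NormedAddCommGroup E] [InnerProductSpace ℝ E] [FiniteDimensional ℝ E] [MeasurableSpace E]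
  [BorelSpace E]

lemma exists_measure_norm_gt_le {X : ℕ → Ω → E} {W : Ω' → E}
    (h : TendstoInDistribution X atTop W (fun _ => μ) ν) {ε : ℝ≥0∞} (hε : 0 < ε) :
    ∃ K : ℝ, 0 ≤ K ∧ ∀ n, μ {ω | K < ‖X n ω‖} ≤ ε := by
  have hmeas := h.forall_aemeasurable
  have hprob : ∀ n, IsProbabilityMeasure (μ.map (X n)) := fun n =>
    Measure.isProbabilityMeasure_map (hmeas n)
  have hprob' : IsProbabilityMeasure (ν.map W) :=
    Measure.isProbabilityMeasure_map h.aemeasurable_limit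
  have ht : IsTightMeasureSet (Set.range fun n => μ.map (X n)) :=
    isTightMeasureSet_of_tendsto_charFun (f := charFun (ν.map W)) (by fun_prop)
      (ProbabilityMeasure.tendsto_iff_tendsto_charFun.1 h.tendsto)
  have h1 := tendsto_measure_norm_gt_of_isTightMeasureSet ht
  obtain ⟨K, hK, hK0⟩ := ((h1.eventually_lt_const hε).and (eventually_ge_atTop 0)).exists
  refine ⟨K, hK0, fun n => ?_⟩
  have h2 : μ.map (X n) {x | K < ‖x‖} = μ {ω | K < ‖X n ω‖} :=
    Measure.map_apply_of_aemeasurable (hmeas n) (measurableSet_lt (by fun_prop) (by fun_prop))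
  rw [← h2]
  refine le_trans ?_ hK.le
  exact le_iSup₂_of_le (μ.map (X n)) ⟨n, rfl⟩ le_rfl

lemma tendstoInMeasure_of_sqrt_smul_tendstoInDistribution {X : ℕ → Ω → E} {W : Ω' → E} {c : E}
    (h : TendstoInDistribution (fun (n : ℕ) ω => √(n : ℝ) • (X n ω - c)) atTop W
      (fun _ => μ) ν) : TendstoInMeasure μ X atTop fun _ => c := by
  rw [tendstoInMeasure_iff_norm]
  intro r hr
  rw [ENNReal.tendsto_nhds_zero]
  intro ε hε
  obtain ⟨K, hK0, hK⟩ := exists_measure_norm_gt_le h hε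
  have hlim : Tendsto (fun n : ℕ => √(n : ℝ)) atTop atTop :=
    Real.tendsto_sqrt_atTop.comp tendsto_natCast_atTop_atTop
  filter_upwards [hlim.eventually_gt_atTop (K / r)] with n hn
  refine (measure_mono fun ω hω => ?_).trans (hK n)
  have hω' : r ≤ ‖X n ω - c‖ := hω
  simp only [Set.mem_ofPred_eq, norm_smul, Real.norm_of_nonneg (Real.sqrt_nonneg _)]
  calc K = K / r * r := by field_simp
    _ < √(n : ℝ) * r := mul_lt_mul_of_pos_right hn hr
    _ ≤ √(n : ℝ) * ‖X n ω - c‖ := mul_le_mul_of_nonneg_left hω' (Real.sqrt_nonneg _)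

end Tight

/-! ### Laws of large numbers for the expansion -/

section LLN

variable {Ω : Type*} [MeasurableSpace Ω] {μ : Measure Ω} [IsProbabilityMeasure μ]

lemma tendsto_measure_taylorRemainder {E : Type*} [NormedAddCommGroup E] [InnerProductSpace ℝ E]
    [FiniteDimensional ℝ E] [MeasurableSpace E] [BorelSpace E] {X : ℕ → Ω → E}
    (hident : ∀ j, IdentDistrib (X j) (X 0) μ μ) (hX : MemLp (X 0) 2 μ) {ρ : ℝ} (hρ : 0 ≤ ρ)
    {η : ℝ} (hη : 0 < η) :
    Tendsto (fun n : ℕ => μ {ω | η ≤ taylorRemainder ρ n fun j => X j ω}) atTop (𝓝 0) := by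
  set g : ℕ → E → ℝ := fun n x => ‖x‖ ^ 2 * min 1 (ρ * ‖x‖ * (√(n : ℝ))⁻¹) with hg
  have hgc : ∀ n, Continuous (g n) := fun n => by fun_prop
  have hg0 : ∀ n x, 0 ≤ g n x := fun n x => by positivity
  have hgle : ∀ n x, g n x ≤ ‖x‖ ^ 2 := fun n x =>
    mul_le_of_le_one_right (sq_nonneg _) (min_le_left _ _)
  have hsq : Integrable (fun ω => ‖X 0 ω‖ ^ 2) μ := hX.integrable_norm_pow (by norm_num)
  have hgi : ∀ n, Integrable (fun ω => g n (X 0 ω)) μ := fun n =>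
    hsq.mono' ((hgc n).comp_aestronglyMeasurable hX.1) (ae_of_all _ fun ω => by
      rw [Real.norm_of_nonneg (hg0 n _)]
      exact hgle n _)
  have hlim0 : Tendsto (fun n : ℕ => (√(n : ℝ))⁻¹) atTop (𝓝 0) :=
    tendsto_inv_atTop_zero.comp (Real.tendsto_sqrt_atTop.comp tendsto_natCast_atTop_atTop)
  have hlim : Tendsto (fun n => ∫ ω, g n (X 0 ω) ∂μ) atTop (𝓝 0) := by
    have := tendsto_integral_of_dominated_convergence (f := fun _ => (0 : ℝ)) (μ := μ)
      (F := fun n ω => g n (X 0 ω)) (fun ω => ‖X 0 ω‖ ^ 2) (fun n => (hgi n).1) hsq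
      (fun n => ae_of_all _ fun ω => by
        rw [Real.norm_of_nonneg (hg0 n _)]
        exact hgle n _) (ae_of_all _ fun ω => ?_)
    · simpa using this
    · have h1 : Tendsto (fun n : ℕ => min 1 (ρ * ‖X 0 ω‖ * (√(n : ℝ))⁻¹)) atTop
          (𝓝 (min 1 (ρ * ‖X 0 ω‖ * 0))) := tendsto_const_nhds.min (hlim0.const_mul _)
      simpa [hg] using h1.const_mul (‖X 0 ω‖ ^ 2)
  have hid : ∀ n j, IdentDistrib (fun ω => g n (X j ω)) (fun ω => g n (X 0 ω)) μ μ :=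
    fun n j => (hident j).comp (hgc n).measurable
  have h_int : ∀ n, ∫ ω, taylorRemainder ρ n (fun j => X j ω) ∂μ ≤ ∫ ω, g n (X 0 ω) ∂μ := by
    intro n
    simp only [taylorRemainder]
    rw [integral_const_mul, integral_finsetSum _ fun j _ => ((hid n j).integrable_iff.2 (hgi n))]
    have : ∀ j ∈ Finset.range n, ∫ ω, ‖X j ω‖ ^ 2 * min 1 (ρ * ‖X j ω‖ * (√(n : ℝ))⁻¹) ∂μ =
        ∫ ω, g n (X 0 ω) ∂μ := fun j _ => (hid n j).integral_eq
    rw [Finset.sum_congr rfl this, Finset.sum_const, Finset.card_range, nsmul_eq_mul, ← mul_assoc]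
    refine mul_le_of_le_one_left (integral_nonneg fun ω => hg0 n _) ?_
    exact inv_mul_le_one
  have hbound : ∀ n : ℕ, μ {ω | η ≤ taylorRemainder ρ n fun j => X j ω} ≤
      ENNReal.ofReal (η⁻¹ * ∫ ω, g n (X 0 ω) ∂μ) := by
    intro n
    have h1 := mul_meas_ge_le_integral_of_nonneg (μ := μ)
      (f := fun ω => taylorRemainder ρ n fun j => X j ω)
      (ae_of_all _ fun ω => by simp only [taylorRemainder, Pi.zero_apply]; positivity)
      ((integrable_finsetSum _ fun j _ => ((hid n j).integrable_iff.2 (hgi n))).const_mul _) η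
    rw [ENNReal.le_ofReal_iff_toReal_le (measure_ne_top _ _)
      (mul_nonneg (inv_nonneg.2 hη.le) (integral_nonneg fun ω => hg0 n _))]
    rw [← div_eq_inv_mul, le_div_iff₀' hη]
    exact h1.trans (h_int n)
  refine tendsto_of_tendsto_of_tendsto_of_le_of_le tendsto_const_nhds ?_ (fun _ => zero_le) hbound
  have := ENNReal.tendsto_ofReal (hlim.const_mul η⁻¹)
  simpa using this

variable {ι : Type*} [Fintype ι]

/-- Sum of the absolute differences between the entries of the weighted second moment matrix of
`x j`, `j < n`, with weights `w (x j)`, and the entries of `A`. -/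
def gramDeviation (w : EuclideanSpace ℝ ι → ℝ) (A : Matrix ι ι ℝ) (n : ℕ)
    (x : ℕ → EuclideanSpace ℝ ι) : ℝ :=
  ∑ i, ∑ k, |(∑ j ∈ Finset.range n, w (x j) * (x j i * x j k)) / n - A i k|

lemma gramDeviation_nonneg (w : EuclideanSpace ℝ ι → ℝ) (A : Matrix ι ι ℝ) (n : ℕ)
    (x : ℕ → EuclideanSpace ℝ ι) : 0 ≤ gramDeviation w A n x :=
  Finset.sum_nonneg fun _ _ => Finset.sum_nonneg fun _ _ => abs_nonneg _

lemma abs_gram_sub_le [DecidableEq ι] (w : EuclideanSpace ℝ ι → ℝ) (A : Matrix ι ι ℝ) (n : ℕ)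
    (x : ℕ → EuclideanSpace ℝ ι) (u : EuclideanSpace ℝ ι) :
    |(n : ℝ)⁻¹ * ∑ j ∈ Finset.range n, w (x j) * ⟪x j, u⟫ ^ 2 -
      ⟪u, Matrix.toEuclideanCLM (𝕜 := ℝ) A u⟫| ≤ gramDeviation w A n x * ‖u‖ ^ 2 := by
  have hcoord : ∀ i, |u i| ≤ ‖u‖ := fun i => by simpa using PiLp.norm_apply_le u i
  have hexp : (n : ℝ)⁻¹ * ∑ j ∈ Finset.range n, w (x j) * ⟪x j, u⟫ ^ 2 -
      ⟪u, Matrix.toEuclideanCLM (𝕜 := ℝ) A u⟫ =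
      ∑ i, ∑ k, ((∑ j ∈ Finset.range n, w (x j) * (x j i * x j k)) / n - A i k) *
        (u i * u k) := by
    rw [Matrix.inner_toEuclideanCLM]
    simp only [sub_mul, Finset.sum_sub_distrib]
    congr 1
    · simp only [div_eq_inv_mul, Finset.mul_sum, Finset.sum_mul]
      have h1 : ∀ i, ∑ k, ∑ j ∈ Finset.range n,
          (n : ℝ)⁻¹ * (w (x j) * (x j i * x j k)) * (u i * u k) =
          ∑ j ∈ Finset.range n, ∑ k,
          (n : ℝ)⁻¹ * (w (x j) * (x j i * x j k)) * (u i * u k) := fun i => Finset.sum_comm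
      simp only [h1]
      rw [Finset.sum_comm]
      refine Finset.sum_congr rfl fun j _ => ?_
      rw [sq, PiLp.inner_apply, Finset.sum_mul_sum, Finset.mul_sum, Finset.mul_sum]
      refine Finset.sum_congr rfl fun i _ => ?_
      rw [Finset.mul_sum, Finset.mul_sum]
      refine Finset.sum_congr rfl fun k _ => ?_
      simp
      ring
    · simp only [dotProduct, Matrix.mulVec, Finset.mul_sum]
      exact Finset.sum_congr rfl fun i _ => Finset.sum_congr rfl fun k _ => by ring
  rw [hexp, gramDeviation, Finset.sum_mul]
  refine (Finset.abs_sum_le_sum_abs _ _).trans (Finset.sum_le_sum fun i _ => ?_)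
  rw [Finset.sum_mul]
  refine (Finset.abs_sum_le_sum_abs _ _).trans (Finset.sum_le_sum fun k _ => ?_)
  rw [abs_mul, abs_mul, sq]
  exact mul_le_mul_of_nonneg_left
    (mul_le_mul (hcoord i) (hcoord k) (abs_nonneg _) (norm_nonneg _)) (abs_nonneg _)

lemma tendsto_measure_gramDeviation {X : ℕ → Ω → EuclideanSpace ℝ ι} (hindep : iIndepFun X μ)
    (hident : ∀ j, IdentDistrib (X j) (X 0) μ μ) {w : EuclideanSpace ℝ ι → ℝ}
    (hw : Measurable w) {A : Matrix ι ι ℝ}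
    (h_int : ∀ i k, Integrable (fun ω => w (X 0 ω) * (X 0 ω i * X 0 ω k)) μ)
    (hA : ∀ i k, A i k = ∫ ω, w (X 0 ω) * (X 0 ω i * X 0 ω k) ∂μ) {η : ℝ} (hη : 0 < η) :
    Tendsto (fun n : ℕ => μ {ω | η ≤ gramDeviation w A n fun j => X j ω}) atTop (𝓝 0) := by
  have mX j := (hident j).aemeasurable_fst
  have hmeas : ∀ i k, Measurable fun x : EuclideanSpace ℝ ι => w x * (x i * x k) :=
    fun i k => hw.mul (by fun_prop)
  have hlim : ∀ᵐ ω ∂μ, ∀ i k, Tendsto (fun n : ℕ =>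
      (∑ j ∈ Finset.range n, w (X j ω) * (X j ω i * X j ω k)) / n) atTop (𝓝 (A i k)) := by
    rw [ae_all_iff]
    intro i
    rw [ae_all_iff]
    intro k
    rw [hA i k]
    refine strong_law_ae_real (fun j ω => w (X j ω) * (X j ω i * X j ω k)) (h_int i k) ?_ ?_
    · intro j j' hj
      exact (hindep.indepFun hj).comp (hmeas i k) (hmeas i k)
    · exact fun j => (hident j).comp (hmeas i k)
  have hae : ∀ᵐ ω ∂μ, Tendsto (fun n : ℕ => gramDeviation w A n fun j => X j ω) atTop
      (𝓝 0) := by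
    filter_upwards [hlim] with ω hω
    have : Tendsto (fun n : ℕ => gramDeviation w A n fun j => X j ω) atTop
        (𝓝 (∑ i : ι, ∑ k : ι, |A i k - A i k|)) :=
      tendsto_finsetSum _ fun i _ => tendsto_finsetSum _ fun k _ => ((hω i k).sub_const _).abs
    simpa using this
  have hm : ∀ n : ℕ, AEStronglyMeasurable (fun ω => gramDeviation w A n fun j => X j ω) μ := by
    intro n
    refine AEMeasurable.aestronglyMeasurable ?_
    refine Finset.aemeasurable_fun_sum _ fun i _ => Finset.aemeasurable_fun_sum _ fun k _ => ?_
    have : AEMeasurable (fun ω => ∑ j ∈ Finset.range n, w (X j ω) * (X j ω i * X j ω k)) μ :=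
      Finset.aemeasurable_fun_sum _ fun j _ => (hmeas i k).comp_aemeasurable (mX j)
    exact measurable_norm.comp_aemeasurable ((this.div_const _).sub_const _)
  have hconv := tendstoInMeasure_of_tendsto_ae (g := fun _ => (0 : ℝ)) hm hae
  rw [tendstoInMeasure_iff_norm] at hconv
  simpa [abs_of_nonneg (gramDeviation_nonneg _ _ _ _)] using hconv η hη

lemma exists_pos_mul_sq_norm_le [DecidableEq ι] {A : Matrix ι ι ℝ} (hA : A.PosDef) :
    ∃ l : ℝ, 0 < l ∧ ∀ v : EuclideanSpace ℝ ι,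
      l * ‖v‖ ^ 2 ≤ ⟪v, Matrix.toEuclideanCLM (𝕜 := ℝ) A v⟫ := by
  have hpos : ∀ v : EuclideanSpace ℝ ι, v ≠ 0 →
      0 < ⟪v, Matrix.toEuclideanCLM (𝕜 := ℝ) A v⟫ := by
    intro v hv
    rw [Matrix.inner_toEuclideanCLM]
    have := hA.dotProduct_mulVec_pos (x := (v : ι → ℝ)) (by simpa using hv)
    simpa using this
  rcases (Metric.sphere (0 : EuclideanSpace ℝ ι) 1).eq_empty_or_nonempty with h | h
  · refine ⟨1, one_pos, fun v => ?_⟩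
    have hv : v = 0 := by
      by_contra hv
      have : (‖v‖⁻¹ • v) ∈ Metric.sphere (0 : EuclideanSpace ℝ ι) 1 := by
        simp [norm_smul, hv]
      rw [h] at this
      exact this
    simp [hv]
  · obtain ⟨v₀, hv₀, hmin⟩ := (isCompact_sphere (0 : EuclideanSpace ℝ ι) 1).exists_isMinOn h
      (f := fun v => ⟪v, Matrix.toEuclideanCLM (𝕜 := ℝ) A v⟫) (by fun_prop)
    have hv₀' : v₀ ≠ 0 := by
      rintro rfl
      simp at hv₀
    refine ⟨_, hpos v₀ hv₀', fun v => ?_⟩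
    rcases eq_or_ne v 0 with rfl | hv
    · simp
    have hmem : (‖v‖⁻¹ • v) ∈ Metric.sphere (0 : EuclideanSpace ℝ ι) 1 := by
      simp [norm_smul, hv]
    have h1 : ⟪v₀, Matrix.toEuclideanCLM (𝕜 := ℝ) A v₀⟫ ≤
        ⟪‖v‖⁻¹ • v, Matrix.toEuclideanCLM (𝕜 := ℝ) A (‖v‖⁻¹ • v)⟫ := hmin hmem
    rw [map_smul, real_inner_smul_left, real_inner_smul_right] at h1
    have hn : 0 < ‖v‖ := norm_pos_iff.2 hv
    calc _ ≤ (‖v‖⁻¹ * (‖v‖⁻¹ * ⟪v, Matrix.toEuclideanCLM (𝕜 := ℝ) A v⟫)) * ‖v‖ ^ 2 :=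
          mul_le_mul_of_nonneg_right h1 (sq_nonneg _)
      _ = _ := by field_simp

end LLN

/-! ### Asymptotics of maximisers of the logistic objective function -/

section Asymptotics

lemma integrable_sigmoidSlope_mul {Ω ι : Type*} [MeasurableSpace Ω] {μ : Measure Ω} [Fintype ι]
    {X : Ω → EuclideanSpace ℝ ι} (hX : MemLp X 2 μ)
    (β : EuclideanSpace ℝ ι) (i k : ι) :
    Integrable (fun ω => sigmoidSlope ⟪X ω, β⟫ * (X ω i * X ω k)) μ := by
  have hcoord : ∀ i, MemLp (fun ω => X ω i) 2 μ := fun i =>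
    (EuclideanSpace.proj (𝕜 := ℝ) i).comp_memLp' hX
  refine (MemLp.integrable_mul (hcoord i) (hcoord k)).bdd_mul (c := 1) ?_ (ae_of_all _ fun ω => ?_)
  · exact continuous_sigmoidSlope.comp_aestronglyMeasurable (hX.inner_const β).1
  · rw [Real.norm_of_nonneg (sigmoidSlope_pos _).le]
    exact sigmoidSlope_le_one _

variable {Ω ι : Type*} [MeasurableSpace Ω] {μ : Measure Ω} [IsProbabilityMeasure μ] [Fintype ι]
  [DecidableEq ι]
  {X : ℕ → Ω → EuclideanSpace ℝ ι} {s : ℕ → Ω → ℝ} {m : ℝ} {β : EuclideanSpace ℝ ι}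
  {A : Matrix ι ι ℝ}

/-- With probability tending to one the logistic objective function has maximisers `b`, and for all
of them `√n (b - β)` is close to the linear approximation `c n`. -/
lemma tendsto_measure_not_close_isMax (hm : 0 < m) (hindep : iIndepFun X μ)
    (hident : ∀ j, IdentDistrib (X j) (X 0) μ μ) (hX : MemLp (X 0) 2 μ)
    (hA : ∀ i k, A i k = ∫ ω, sigmoidSlope ⟪X 0 ω, β⟫ * (X 0 ω i * X 0 ω k) ∂μ)
    (hApos : A.PosDef) {c : ℕ → Ω → EuclideanSpace ℝ ι}
    (hc : ∀ n ω, m • Matrix.toEuclideanCLM (𝕜 := ℝ) A (c n ω) = (√(n : ℝ))⁻¹ •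
      ∑ j ∈ Finset.range n, (s j ω - m * Real.sigmoid ⟪X j ω, β⟫) • X j ω)
    (htight : ∀ ε : ℝ≥0∞, 0 < ε → ∃ K : ℝ, 0 ≤ K ∧ ∀ n, μ {ω | K < ‖c n ω‖} ≤ ε)
    {δ : ℝ} (hδ : 0 < δ) :
    Tendsto (fun n : ℕ => μ {ω | ¬ ((∃ b, ∀ b',
        logisticObjective m n (fun j => s j ω) (fun j => X j ω) b' ≤
          logisticObjective m n (fun j => s j ω) (fun j => X j ω) b) ∧
      ∀ b, (∀ b', logisticObjective m n (fun j => s j ω) (fun j => X j ω) b' ≤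
          logisticObjective m n (fun j => s j ω) (fun j => X j ω) b) →
        ‖√(n : ℝ) • (b - β) - c n ω‖ ≤ δ)}) atTop (𝓝 0) := by
  obtain ⟨l, hl0, hl⟩ := exists_pos_mul_sq_norm_le hApos
  have hsymm : (Matrix.toEuclideanCLM (𝕜 := ℝ) A).IsSymmetric := by
    rw [Matrix.coe_toEuclideanCLM_eq_toEuclideanLin]
    exact Matrix.isSymmetric_toEuclideanLin_iff.2 hApos.isHermitian
  rw [ENNReal.tendsto_nhds_zero]
  intro ε hε
  have hε3 : 0 < ε / 3 := ENNReal.div_pos hε.ne' (by simp)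
  obtain ⟨K, hK0, hK⟩ := htight _ hε3
  have hρ : 0 < K + δ := by linarith
  have hη : 0 < l * δ ^ 2 / (6 * (K + δ) ^ 2) := by positivity
  set η := l * δ ^ 2 / (6 * (K + δ) ^ 2) with hηdef
  have hwm : Measurable fun x : EuclideanSpace ℝ ι => sigmoidSlope ⟪x, β⟫ :=
    (continuous_sigmoidSlope.comp (by fun_prop)).measurable
  have h1 := tendsto_measure_taylorRemainder hident hX hρ.le hη
  have h2 := tendsto_measure_gramDeviation hindep hident hwm
    (integrable_sigmoidSlope_mul hX β) hA hη
  rw [ENNReal.tendsto_nhds_zero] at h1 h2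
  filter_upwards [h1 _ hε3, h2 _ hε3, eventually_gt_atTop 0] with n hn1 hn2 hn
  calc _ ≤ μ ({ω | K < ‖c n ω‖} ∪ ({ω | η ≤ taylorRemainder (K + δ) n fun j => X j ω} ∪
        {ω | η ≤ gramDeviation (fun x => sigmoidSlope ⟪x, β⟫) A n fun j => X j ω})) := by
        refine measure_mono fun ω hω => ?_
        by_contra hout
        simp only [Set.mem_union, Set.mem_ofPred_eq, not_or, not_lt, not_le] at hout
        obtain ⟨ho1, ho2, ho3⟩ := hout
        refine hω (exists_isMax_logisticObjective hm hn _ _ β hsymm hl (hc n ω)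
          (gramDeviation_nonneg _ _ _ _)
          (abs_gram_sub_le (fun x => sigmoidSlope ⟪x, β⟫) A n fun j => X j ω) hδ ho1 ?_)
        calc _ < (K + δ) ^ 2 * (2 * η + η) := by gcongr
          _ = l * δ ^ 2 / 2 := by
            rw [hηdef]
            field_simp
            ring
    _ ≤ ε / 3 + (ε / 3 + ε / 3) :=
      (measure_union_le _ _).trans (add_le_add (hK n)
        ((measure_union_le _ _).trans (add_le_add hn1 hn2)))
    _ = ε := by rw [← add_assoc, ENNReal.add_thirds]

/-- Existence with probability tending to one and asymptotic normality of maximisers of the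
logistic objective function, when the score has mean zero and its second moment matrix is
proportional to the weighted second moment matrix `A` of the regressors. -/
theorem logisticObjective_asymptotics (hm : 0 < m)
    (hindep : iIndepFun (fun j ω => (X j ω, s j ω)) μ)
    (hident : ∀ j, IdentDistrib (fun ω => (X j ω, s j ω)) (fun ω => (X 0 ω, s 0 ω)) μ μ)
    (hX : MemLp (X 0) 2 μ)
    (hA : ∀ i k, A i k = ∫ ω, sigmoidSlope ⟪X 0 ω, β⟫ * (X 0 ω i * X 0 ω k) ∂μ)
    (hApos : A.PosDef)
    (hscore : MemLp (fun ω => (s 0 ω - m * Real.sigmoid ⟪X 0 ω, β⟫) • X 0 ω) 2 μ)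
    (hmean : ∫ ω, (s 0 ω - m * Real.sigmoid ⟪X 0 ω, β⟫) • X 0 ω ∂μ = 0)
    {κ : ℝ} (hκ : 0 ≤ κ)
    (hvar : ∀ t : EuclideanSpace ℝ ι,
      ∫ ω, ⟪(s 0 ω - m * Real.sigmoid ⟪X 0 ω, β⟫) • X 0 ω, t⟫ ^ 2 ∂μ = κ * (t ⬝ᵥ A.mulVec t))
    {b : ℕ → Ω → EuclideanSpace ℝ ι} (hb : ∀ n, AEMeasurable (b n) μ)
    (hmax : ∀ n, ∀ᵐ ω ∂μ,
      (∃ b, ∀ b', logisticObjective m n (fun j => s j ω) (fun j => X j ω) b' ≤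
          logisticObjective m n (fun j => s j ω) (fun j => X j ω) b) →
        ∀ b', logisticObjective m n (fun j => s j ω) (fun j => X j ω) b' ≤
          logisticObjective m n (fun j => s j ω) (fun j => X j ω) (b n ω)) :
    Tendsto (fun n : ℕ => μ {ω | ¬ ∃ b, ∀ b',
        logisticObjective m n (fun j => s j ω) (fun j => X j ω) b' ≤
          logisticObjective m n (fun j => s j ω) (fun j => X j ω) b}) atTop (𝓝 0) ∧
    TendstoInDistribution (fun (n : ℕ) ω => √(n : ℝ) • (b n ω - β)) atTop id (fun _ => μ)
      (multivariateGaussian 0 ((κ / m ^ 2) • A⁻¹)) := by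
  set ψ : EuclideanSpace ℝ ι × ℝ → EuclideanSpace ℝ ι := fun q =>
    m⁻¹ • Matrix.toEuclideanCLM (𝕜 := ℝ) A⁻¹ ((q.2 - m * Real.sigmoid ⟪q.1, β⟫) • q.1) with hψ
  have hψm : Measurable ψ := by
    have hsig : Measurable fun q : EuclideanSpace ℝ ι × ℝ => Real.sigmoid ⟪q.1, β⟫ :=
      (continuous_sigmoid.comp (by fun_prop)).measurable
    have h1 : Measurable fun q : EuclideanSpace ℝ ι × ℝ =>
        (q.2 - m * Real.sigmoid ⟪q.1, β⟫) • q.1 :=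
      (measurable_snd.sub (hsig.const_mul m)).smul measurable_fst
    exact ((Matrix.toEuclideanCLM (𝕜 := ℝ) A⁻¹).continuous.measurable.comp h1).const_smul m⁻¹
  have hdet : IsUnit A.det := hApos.det_pos.ne'.isUnit
  have hiX : iIndepFun X μ := hindep.comp (fun _ q => q.1) fun _ => measurable_fst
  have hidX : ∀ j, IdentDistrib (X j) (X 0) μ μ := fun j => (hident j).comp measurable_fst
  set c : ℕ → Ω → EuclideanSpace ℝ ι := fun n ω =>
    (√(n : ℝ))⁻¹ • ∑ j ∈ Finset.range n, ψ (X j ω, s j ω) with hcdef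
  have hinv : ∀ v, Matrix.toEuclideanCLM (𝕜 := ℝ) A (Matrix.toEuclideanCLM (𝕜 := ℝ) A⁻¹ v) = v := by
    intro v
    rw [← mul_apply_eq_comp, ← map_mul, Matrix.mul_nonsing_inv _ hdet, map_one,
      one_apply_eq_self]
  have hc : ∀ n ω, m • Matrix.toEuclideanCLM (𝕜 := ℝ) A (c n ω) = (√(n : ℝ))⁻¹ •
      ∑ j ∈ Finset.range n, (s j ω - m * Real.sigmoid ⟪X j ω, β⟫) • X j ω := by
    intro n ω
    simp only [hcdef, hψ]
    rw [map_smul, map_sum, smul_comm, Finset.smul_sum]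
    congr 1
    refine Finset.sum_congr rfl fun j _ => ?_
    rw [map_smul (Matrix.toEuclideanCLM (𝕜 := ℝ) A) m⁻¹, hinv, smul_smul, mul_inv_cancel₀ hm.ne',
      one_smul]
  have hψL : MemLp (fun ω => ψ (X 0 ω, s 0 ω)) 2 μ :=
    ((Matrix.toEuclideanCLM (𝕜 := ℝ) A⁻¹).comp_memLp' hscore).const_smul m⁻¹
  have hψ0 : ∫ ω, ψ (X 0 ω, s 0 ω) ∂μ = 0 := by
    simp only [hψ]
    rw [integral_smul, ContinuousLinearMap.integral_comp_comm _ (hscore.integrable (by norm_num)),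
      hmean, map_zero, smul_zero]
  have hinvpos : A⁻¹.PosSemidef := hApos.posSemidef.inv
  have hsymm : (Matrix.toEuclideanCLM (𝕜 := ℝ) A⁻¹).IsSymmetric := by
    rw [Matrix.coe_toEuclideanCLM_eq_toEuclideanLin]
    exact Matrix.isSymmetric_toEuclideanLin_iff.2 hinvpos.isHermitian
  have hV : ((κ / m ^ 2) • A⁻¹).PosSemidef := hinvpos.smul (by positivity)
  have hclt : TendstoInDistribution c atTop id (fun _ => μ)
      (multivariateGaussian 0 ((κ / m ^ 2) • A⁻¹)) := by
    refine tendstoInDistribution_inv_sqrt_smul_sum (X := fun j ω => ψ (X j ω, s j ω)) hψL hψ0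
      (hindep.comp (fun _ => ψ) fun _ => hψm) (fun j => (hident j).comp hψm) hV fun t => ?_
    have h0 : ∫ ω, ⟪ψ (X 0 ω, s 0 ω), t⟫ ∂μ = 0 := by
      simp_rw [real_inner_comm]
      rw [integral_inner (hψL.integrable (by norm_num)), hψ0, inner_zero_right]
    rw [variance_of_integral_eq_zero (hψL.inner_const t).1.aemeasurable h0]
    set t' := Matrix.toEuclideanCLM (𝕜 := ℝ) A⁻¹ t with ht'
    have h1 : ∀ ω, ⟪ψ (X 0 ω, s 0 ω), t⟫ ^ 2 = (m⁻¹) ^ 2 *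
        ⟪(s 0 ω - m * Real.sigmoid ⟪X 0 ω, β⟫) • X 0 ω, t'⟫ ^ 2 := by
      intro ω
      simp only [hψ]
      rw [real_inner_smul_left, mul_pow]
      congr 2
      exact hsymm _ t
    simp_rw [h1]
    rw [integral_const_mul, hvar, ← Matrix.inner_toEuclideanCLM, ht', hinv, real_inner_comm,
      Matrix.inner_toEuclideanCLM, Matrix.smul_mulVec, dotProduct_smul, smul_eq_mul]
    field_simp
  have hgood := fun δ (hδ : 0 < δ) => tendsto_measure_not_close_isMax (s := s) (δ := δ) hm hiX hidX
    hX hA hApos hc (fun ε hε => exists_measure_norm_gt_le hclt hε) hδ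
  constructor
  · refine tendsto_of_tendsto_of_tendsto_of_le_of_le tendsto_const_nhds (hgood 1 one_pos)
      (fun _ => zero_le) fun n => measure_mono fun ω hω h => hω h.1
  · have hmeasb : ∀ n : ℕ, AEMeasurable (fun ω => √(n : ℝ) • (b n ω - β)) μ :=
      fun n => ((hb n).sub_const β).fun_const_smul _
    refine tendstoInDistribution_of_tendstoInMeasure_sub _ _ hclt ?_ hmeasb
    rw [tendstoInMeasure_iff_norm]
    intro r hr
    refine tendsto_of_tendsto_of_tendsto_of_le_of_le tendsto_const_nhds (hgood (r / 2) (by linarith))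
      (fun _ => zero_le) fun n => measure_mono_ae ?_
    filter_upwards [hmax n] with ω hω hle h
    have h1 := h.2 _ (hω h.1)
    have h2 : r ≤ ‖√(n : ℝ) • (b n ω - β) - c n ω - 0‖ := hle
    rw [sub_zero] at h2
    linarith

end Asymptotics

/-! ### Moments of the Dirichlet-Multinomial distribution with two categories -/

section DirichletMultinomial

/-- Unnormalised Dirichlet-Multinomial weights with two categories. -/
def gammaWeight (a b : ℝ) (q : ℕ × ℕ) : ℝ :=
  Real.Gamma (q.1 + a) * Real.Gamma (q.2 + b) / (q.1 ! * q.2 !)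

lemma succ_mul_gammaWeight_left (a b : ℝ) (i j : ℕ) :
    ((i + 1 : ℕ) : ℝ) * gammaWeight a b (i + 1, j) = gammaWeight (a + 1) b (i, j) := by
  simp only [gammaWeight, Nat.factorial_succ]
  have : ((i + 1 : ℕ) : ℝ) + a = i + (a + 1) := by push_cast; ring
  rw [this]
  push_cast
  field_simp

lemma succ_mul_gammaWeight_right (a b : ℝ) (i j : ℕ) :
    ((j + 1 : ℕ) : ℝ) * gammaWeight a b (i, j + 1) = gammaWeight a (b + 1) (i, j) := by
  simp only [gammaWeight, Nat.factorial_succ]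
  have : ((j + 1 : ℕ) : ℝ) + b = j + (b + 1) := by push_cast; ring
  rw [this]
  push_cast
  field_simp

lemma sum_fst_mul_gammaWeight_succ (f : ℕ → ℝ) (a b : ℝ) (m : ℕ) :
    ∑ q ∈ Finset.HasAntidiagonal.antidiagonal (m + 1), f q.1 * (q.1 * gammaWeight a b q) =
      ∑ q ∈ Finset.HasAntidiagonal.antidiagonal m, f (q.1 + 1) * gammaWeight (a + 1) b q := by
  rw [Finset.Nat.sum_antidiagonal_succ]
  simp only [Nat.cast_zero, zero_mul, mul_zero, zero_add]
  refine Finset.sum_congr rfl fun q _ => ?_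
  rw [succ_mul_gammaWeight_left]

lemma sum_snd_mul_gammaWeight_succ (a b : ℝ) (m : ℕ) :
    ∑ q ∈ Finset.HasAntidiagonal.antidiagonal (m + 1), (q.2 * gammaWeight a b q) =
      ∑ q ∈ Finset.HasAntidiagonal.antidiagonal m, gammaWeight a (b + 1) q := by
  rw [Finset.Nat.sum_antidiagonal_succ']
  simp only [Nat.cast_zero, zero_mul, zero_add]
  refine Finset.sum_congr rfl fun q _ => ?_
  rw [succ_mul_gammaWeight_right]

/-- The normalising constant of the Dirichlet-Multinomial distribution with two categories. -/
lemma sum_gammaWeight {a b : ℝ} (ha : 0 < a) (hb : 0 < b) (m : ℕ) :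
    ∑ q ∈ Finset.HasAntidiagonal.antidiagonal m, gammaWeight a b q =
      Real.Gamma a * Real.Gamma b * Real.Gamma (m + (a + b)) / (m ! * Real.Gamma (a + b)) := by
  induction m generalizing a b with
  | zero =>
    have := (Real.Gamma_pos_of_pos (add_pos ha hb)).ne'
    simp [gammaWeight]
    field_simp
  | succ m ih =>
    have hab := (Real.Gamma_pos_of_pos (add_pos ha hb)).ne'
    have hsplit : ((m + 1 : ℕ) : ℝ) * ∑ q ∈ Finset.HasAntidiagonal.antidiagonal (m + 1), gammaWeight a b q =
        ∑ q ∈ Finset.HasAntidiagonal.antidiagonal m, gammaWeight (a + 1) b q +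
          ∑ q ∈ Finset.HasAntidiagonal.antidiagonal m, gammaWeight a (b + 1) q := by
      have h1 := sum_fst_mul_gammaWeight_succ (fun _ => 1) a b m
      simp only [one_mul] at h1
      rw [← h1, ← sum_snd_mul_gammaWeight_succ, ← Finset.sum_add_distrib, Finset.mul_sum]
      refine Finset.sum_congr rfl fun q hq => ?_
      rw [← Finset.HasAntidiagonal.mem_antidiagonal.1 hq]
      push_cast
      ring
    have hm : ((m + 1 : ℕ) : ℝ) ≠ 0 := by positivity
    rw [← mul_right_inj' hm, hsplit, ih (by linarith) hb, ih ha (by linarith),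
      Real.Gamma_add_one ha.ne', Real.Gamma_add_one hb.ne', Nat.factorial_succ,
      show a + 1 + b = a + b + 1 by ring, show a + (b + 1) = a + b + 1 by ring,
      Real.Gamma_add_one (add_pos ha hb).ne',
      show (m : ℝ) + (a + b + 1) = ((m + 1 : ℕ) : ℝ) + (a + b) by push_cast; ring]
    push_cast
    have := (add_pos ha hb).ne'
    field_simp

lemma sum_fst_mul_gammaWeight {a b : ℝ} (ha : 0 < a) (hb : 0 < b) (m : ℕ) :
    ∑ q ∈ Finset.HasAntidiagonal.antidiagonal m, (q.1 * gammaWeight a b q) =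
      m * (a / (a + b)) * ∑ q ∈ Finset.HasAntidiagonal.antidiagonal m, gammaWeight a b q := by
  cases m with
  | zero => simp
  | succ m =>
    have h1 := sum_fst_mul_gammaWeight_succ (fun _ => 1) a b m
    simp only [one_mul] at h1
    have hab := (Real.Gamma_pos_of_pos (add_pos ha hb)).ne'
    rw [h1, sum_gammaWeight (by linarith) hb, sum_gammaWeight ha hb, Real.Gamma_add_one ha.ne',
      show a + 1 + b = a + b + 1 by ring, Real.Gamma_add_one (add_pos ha hb).ne',
      show (m : ℝ) + (a + b + 1) = ((m + 1 : ℕ) : ℝ) + (a + b) by push_cast; ring,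
      Nat.factorial_succ]
    push_cast
    have := (add_pos ha hb).ne'
    field_simp

lemma sum_fst_mul_pred_mul_gammaWeight {a b : ℝ} (ha : 0 < a) (hb : 0 < b) (m : ℕ) :
    ∑ q ∈ Finset.HasAntidiagonal.antidiagonal m, ((q.1 - 1 : ℝ) * (q.1 * gammaWeight a b q)) =
      m * (m - 1) * (a / (a + b)) * ((a + 1) / (a + b + 1)) *
        ∑ q ∈ Finset.HasAntidiagonal.antidiagonal m, gammaWeight a b q := by
  cases m with
  | zero => simp
  | succ m =>
    have h1 := sum_fst_mul_gammaWeight_succ (fun k => (k : ℝ) - 1) a b m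
    have h2 := sum_fst_mul_gammaWeight_succ (fun _ => 1) a b m
    have h3 := sum_fst_mul_gammaWeight ha hb (m + 1)
    simp only [one_mul] at h2
    rw [h1]
    have : ∀ q : ℕ × ℕ, (((q.1 + 1 : ℕ) : ℝ) - 1) * gammaWeight (a + 1) b q =
        q.1 * gammaWeight (a + 1) b q := fun q => by push_cast; ring
    simp only [this]
    rw [sum_fst_mul_gammaWeight (by linarith) hb, ← h2, h3, show a + 1 + b = a + b + 1 by ring]
    push_cast
    ring

/-- The count vectors of two categories with total `m`. -/
def countVectors (m : ℕ) : Finset (Fin 2 → ℕ) :=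
  (Finset.HasAntidiagonal.antidiagonal m).map (finTwoArrowEquiv ℕ).symm.toEmbedding

lemma sum_countVectors (m : ℕ) (f : (Fin 2 → ℕ) → ℝ) :
    ∑ s ∈ countVectors m, f s = ∑ q ∈ Finset.HasAntidiagonal.antidiagonal m, f ![q.1, q.2] := by
  simp [countVectors]

lemma apply_zero_le_of_mem_countVectors {m : ℕ} {s : Fin 2 → ℕ} (hs : s ∈ countVectors m) :
    s 0 ≤ m := by
  simp only [countVectors, Finset.mem_map, Finset.HasAntidiagonal.mem_antidiagonal] at hs
  obtain ⟨q, hq, rfl⟩ := hs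
  simp
  omega

lemma dirichletMultinomialPMF_eq {m : ℕ} {a : Fin 2 → ℝ} (ha : ∀ i, 0 < a i) {q : ℕ × ℕ}
    (hq : q ∈ Finset.HasAntidiagonal.antidiagonal m) :
    dirichletMultinomialPMF m a ![q.1, q.2] = gammaWeight (a 0) (a 1) q /
      ∑ q ∈ Finset.HasAntidiagonal.antidiagonal m, gammaWeight (a 0) (a 1) q := by
  have h0 := (Real.Gamma_pos_of_pos (ha 0)).ne'
  have h1 := (Real.Gamma_pos_of_pos (ha 1)).ne'
  have hab := (Real.Gamma_pos_of_pos (add_pos (ha 0) (ha 1))).ne'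
  have hm := (Real.Gamma_pos_of_pos (add_pos_of_nonneg_of_pos (Nat.cast_nonneg m)
    (add_pos (ha 0) (ha 1)))).ne'
  rw [sum_gammaWeight (ha 0) (ha 1), dirichletMultinomialPMF, gammaWeight]
  simp only [Fin.sum_univ_two, Fin.prod_univ_two, Matrix.cons_val_zero, Matrix.cons_val_one,
    Finset.HasAntidiagonal.mem_antidiagonal.1 hq, if_true]
  field_simp

/-- Total mass, mean and variance of the first count under the Dirichlet-Multinomial distribution
with parameters `α₀ σ` and `α₀ (1 - σ)`. -/
lemma dirichletMultinomialPMF_moments (m : ℕ) {α₀ σ : ℝ} (hα : 0 < α₀) (hσ0 : 0 < σ) (hσ1 : σ < 1)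
    {a : Fin 2 → ℝ} (ha0 : a 0 = α₀ * σ) (ha1 : a 1 = α₀ * (1 - σ)) :
    ∑ s ∈ countVectors m, dirichletMultinomialPMF m a s = 1 ∧
    ∑ s ∈ countVectors m, (s 0 - m * σ) * dirichletMultinomialPMF m a s = 0 ∧
    ∑ s ∈ countVectors m, (s 0 - m * σ) ^ 2 * dirichletMultinomialPMF m a s =
      m * (m + α₀) / (1 + α₀) * (σ * (1 - σ)) := by
  have p0 : 0 < a 0 := ha0 ▸ mul_pos hα hσ0
  have p1 : 0 < a 1 := ha1 ▸ mul_pos hα (sub_pos.2 hσ1)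
  have hsum : a 0 + a 1 = α₀ := by rw [ha0, ha1]; ring
  have hpos : ∀ i, 0 < a i := fun i => by fin_cases i <;> assumption
  set N := ∑ q ∈ Finset.HasAntidiagonal.antidiagonal m, gammaWeight (a 0) (a 1) q with hN
  have hN0 : N ≠ 0 := by
    rw [hN, sum_gammaWeight p0 p1]
    have h1 := Real.Gamma_pos_of_pos p0
    have h2 := Real.Gamma_pos_of_pos p1
    have h3 := Real.Gamma_pos_of_pos (add_pos p0 p1)
    have h4 := Real.Gamma_pos_of_pos (add_pos_of_nonneg_of_pos (Nat.cast_nonneg m) (add_pos p0 p1))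
    positivity
  have e1 := sum_fst_mul_gammaWeight p0 p1 m
  have e2 := sum_fst_mul_pred_mul_gammaWeight p0 p1 m
  rw [← hN, hsum] at e1 e2
  have hratio : a 0 / α₀ = σ := by rw [ha0]; field_simp
  rw [hratio] at e1 e2
  have hexp : ∀ f : ℕ → ℝ, ∑ s ∈ countVectors m, f (s 0) * dirichletMultinomialPMF m a s =
      (∑ q ∈ Finset.HasAntidiagonal.antidiagonal m, f q.1 * gammaWeight (a 0) (a 1) q) / N := by
    intro f
    rw [sum_countVectors, Finset.sum_div]
    refine Finset.sum_congr rfl fun q hq => ?_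
    rw [dirichletMultinomialPMF_eq hpos hq]
    simp only [Matrix.cons_val_zero]
    ring
  refine ⟨?_, ?_, ?_⟩
  · have := hexp fun _ => 1
    simp only [one_mul] at this
    rw [this, ← hN, div_self hN0]
  · rw [hexp fun k => (k : ℝ) - m * σ]
    simp only [sub_mul, Finset.sum_sub_distrib, ← Finset.mul_sum]
    rw [e1, ← hN, sub_self, zero_div]
  · rw [hexp fun k => ((k : ℝ) - m * σ) ^ 2]
    have : ∀ q : ℕ × ℕ, ((q.1 : ℝ) - m * σ) ^ 2 * gammaWeight (a 0) (a 1) q =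
        (q.1 - 1 : ℝ) * (q.1 * gammaWeight (a 0) (a 1) q) +
          (1 - 2 * (m * σ)) * (q.1 * gammaWeight (a 0) (a 1) q) +
          (m * σ) ^ 2 * gammaWeight (a 0) (a 1) q := fun q => by ring
    simp only [this, Finset.sum_add_distrib, ← Finset.mul_sum]
    rw [e1, e2, ← hN, ha0]
    have : α₀ + 1 ≠ 0 := by positivity
    have : 1 + α₀ ≠ 0 := by positivity
    field_simp
    ring

end DirichletMultinomial

/-! ### Integrals of functions of features and a discrete response -/

section ConditionalLaw

variable {Ω F R : Type*} [MeasurableSpace Ω] {μ : Measure Ω} [IsProbabilityMeasure μ]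
  [MeasurableSpace F] [MeasurableSpace R] [MeasurableSingletonClass R]
  {Y : Ω → F} {W : Ω → R} {q : R → F → ℝ} {T : Finset R}

lemma integrable_mul_condProb_and_integral_eq (hY : Measurable Y) (hW : Measurable W) {s : R}
    (hlaw : μ⟦W ⁻¹' {s} | MeasurableSpace.comap Y inferInstance⟧ =ᵐ[μ] fun ω => q s (Y ω))
    {g : F → ℝ} (hg : Measurable g) (hgi : Integrable (fun ω => g (Y ω)) μ) :
    Integrable (fun ω => g (Y ω) * q s (Y ω)) μ ∧
    ∫ ω, g (Y ω) * (W ⁻¹' {s}).indicator (fun _ => (1 : ℝ)) ω ∂μ =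
      ∫ ω, g (Y ω) * q s (Y ω) ∂μ := by
  have hle : MeasurableSpace.comap Y inferInstance ≤ (inferInstance : MeasurableSpace Ω) :=
    hY.comap_le
  have hset : MeasurableSet (W ⁻¹' {s}) := hW (measurableSet_singleton s)
  have hind : Integrable ((W ⁻¹' {s}).indicator fun _ => (1 : ℝ)) μ :=
    (integrable_const 1).indicator hset
  have hprod : Integrable ((fun ω => g (Y ω)) * (W ⁻¹' {s}).indicator fun _ => (1 : ℝ)) μ := by
    have : (fun ω => g (Y ω)) * ((W ⁻¹' {s}).indicator fun _ => (1 : ℝ)) =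
        (W ⁻¹' {s}).indicator fun ω => g (Y ω) := by
      ext ω
      by_cases h : ω ∈ W ⁻¹' {s} <;> simp [h]
    rw [this]
    exact hgi.indicator hset
  have hpull := condExp_mul_of_stronglyMeasurable_left (μ := μ)
    (m := MeasurableSpace.comap Y inferInstance) (f := fun ω => g (Y ω))
    (hg.comp (comap_measurable Y)).stronglyMeasurable hprod hind
  have hae : μ[(fun ω => g (Y ω)) * (W ⁻¹' {s}).indicator fun _ => (1 : ℝ) |
      MeasurableSpace.comap Y inferInstance] =ᵐ[μ] fun ω => g (Y ω) * q s (Y ω) := by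
    filter_upwards [hpull, hlaw] with ω h1 h2
    rw [h1, Pi.mul_apply, h2]
  refine ⟨integrable_condExp.congr hae, ?_⟩
  rw [← integral_congr_ae hae, integral_condExp hle]
  rfl

/-- If the conditional probabilities of the values in `T` add up to one, then the response takes
values in `T`. -/
lemma ae_mem_of_condProb (hY : Measurable Y) (hW : Measurable W)
    (hlaw : ∀ s ∈ T, μ⟦W ⁻¹' {s} | MeasurableSpace.comap Y inferInstance⟧ =ᵐ[μ]
      fun ω => q s (Y ω)) (hsum : ∀ y, ∑ s ∈ T, q s y = 1) : ∀ᵐ ω ∂μ, W ω ∈ T := by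
  have hT : MeasurableSet (W ⁻¹' (T : Set R)) := hW T.measurableSet
  have hone := fun s (hs : s ∈ T) => integrable_mul_condProb_and_integral_eq hY hW (hlaw s hs)
    (g := fun _ => 1) measurable_const (integrable_const 1)
  simp only [one_mul] at hone
  have hreal : μ.real (W ⁻¹' (T : Set R)) = 1 := by
    have h1 : W ⁻¹' (T : Set R) = ⋃ s ∈ T, W ⁻¹' {s} := by
      ext ω
      simp
    rw [h1, measureReal_biUnion_finset]
    · have h2 : ∀ s ∈ T, μ.real (W ⁻¹' {s}) = ∫ ω, q s (Y ω) ∂μ := by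
        intro s hs
        rw [← (hone s hs).2, integral_indicator_const _ (hW (measurableSet_singleton s))]
        simp
      rw [Finset.sum_congr rfl h2, ← integral_finsetSum _ fun s hs => (hone s hs).1]
      simp [hsum]
    · intro s _ s' _ hss
      exact Disjoint.preimage W (Set.disjoint_singleton.2 hss)
    · exact fun s _ => hW (measurableSet_singleton s)
  have := (prob_compl_eq_zero_iff hT).2 (by
    rw [measureReal_def] at hreal
    exact (ENNReal.toReal_eq_one_iff _).1 hreal)
  rw [ae_iff]
  exact this

lemma integral_response_eq (hY : Measurable Y) (hW : Measurable W)
    (hlaw : ∀ s ∈ T, μ⟦W ⁻¹' {s} | MeasurableSpace.comap Y inferInstance⟧ =ᵐ[μ]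
      fun ω => q s (Y ω)) (hsum : ∀ y, ∑ s ∈ T, q s y = 1) {g : R → F → ℝ}
    (hg : ∀ s ∈ T, Measurable (g s)) (hgi : ∀ s ∈ T, Integrable (fun ω => g s (Y ω)) μ) :
    ∫ ω, g (W ω) (Y ω) ∂μ = ∫ ω, ∑ s ∈ T, g s (Y ω) * q s (Y ω) ∂μ := by
  have hcond := fun s (hs : s ∈ T) => integrable_mul_condProb_and_integral_eq hY hW (hlaw s hs)
    (hg s hs) (hgi s hs)
  have hae : (fun ω => g (W ω) (Y ω)) =ᵐ[μ]
      fun ω => ∑ s ∈ T, g s (Y ω) * (W ⁻¹' {s}).indicator (fun _ => (1 : ℝ)) ω := by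
    filter_upwards [ae_mem_of_condProb hY hW hlaw hsum] with ω hω
    rw [Finset.sum_eq_single_of_mem (W ω) hω]
    · simp
    · intro s _ hs
      rw [Set.indicator_of_notMem, mul_zero]
      exact fun h => hs h.symm
  rw [integral_congr_ae hae, integral_finsetSum _ fun s hs => ?_,
    integral_finsetSum _ fun s hs => (hcond s hs).1]
  · exact Finset.sum_congr rfl fun s hs => (hcond s hs).2
  · refine (hgi s hs).mul_bdd (c := 1) ?_ (ae_of_all _ fun ω => ?_)
    · exact ((integrable_const (1 : ℝ)).indicator (hW (measurableSet_singleton s))).1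
    · refine (norm_indicator_le_norm_self _ _).trans ?_
      simp

end ConditionalLaw

/-! ### Regressors, score and Hessian -/

section Score

variable {p : ℕ}

/-- The vector of regressors: the intercept and the features. -/
def design (y : EuclideanSpace ℝ (Fin p)) : EuclideanSpace ℝ (Fin (p + 1)) :=
  WithLp.toLp 2 (Fin.cons 1 fun i => y i)

@[simp] lemma design_zero (y : EuclideanSpace ℝ (Fin p)) : design y 0 = 1 := rfl

@[simp] lemma design_succ (y : EuclideanSpace ℝ (Fin p)) (i : Fin p) : design y i.succ = y i := rfl

lemma linPred_eq_inner (b : EuclideanSpace ℝ (Fin (p + 1))) (y : EuclideanSpace ℝ (Fin p)) :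
    linPred b y = ⟪design y, b⟫ := by
  simp [linPred, PiLp.inner_apply, Fin.sum_univ_succ]

lemma measurable_design : Measurable (design (p := p)) := by
  refine (WithLp.measurable_toLp 2 _).comp (measurable_pi_iff.2 fun i => ?_)
  refine Fin.cases ?_ (fun i => ?_) i
  · exact measurable_const
  · simp only [Fin.cons_succ]
    fun_prop

lemma memLp_design {Ω : Type*} [MeasurableSpace Ω] {μ : Measure Ω} [IsFiniteMeasure μ]
    {Y : Ω → EuclideanSpace ℝ (Fin p)} (hY : MemLp Y 2 μ) :
    MemLp (fun ω => design (Y ω)) 2 μ := by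
  refine MemLp.of_eval_piLp fun i => ?_
  refine Fin.cases ?_ (fun i => ?_) i
  · exact memLp_const 1
  · exact hY.eval_piLp i

lemma classProb_zero (b : EuclideanSpace ℝ (Fin (p + 1))) (y : EuclideanSpace ℝ (Fin p)) :
    classProb b y 0 = Real.sigmoid ⟪design y, b⟫ := by
  simp [classProb, exp_div_one_add_exp, linPred_eq_inner]

lemma classProb_one (b : EuclideanSpace ℝ (Fin (p + 1))) (y : EuclideanSpace ℝ (Fin p)) :
    classProb b y 1 = 1 - Real.sigmoid ⟪design y, b⟫ := by
  simp [classProb, exp_div_one_add_exp, linPred_eq_inner]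

lemma labelLogLik_eq_voteLogLik (z : Fin 2 → ℕ) (y : EuclideanSpace ℝ (Fin p)) :
    labelLogLik z y = voteLogLik 1 z y := by
  ext b
  simp [labelLogLik, voteLogLik]

lemma sampleVoteLogLik_eq_logisticObjective (m n : ℕ) (s : ℕ → Fin 2 → ℕ)
    (y : ℕ → EuclideanSpace ℝ (Fin p)) (b : EuclideanSpace ℝ (Fin (p + 1))) :
    sampleVoteLogLik m n s y b =
      logisticObjective (m : ℝ) n (fun j => (s j 0 : ℝ)) (fun j => design (y j)) b := by
  simp [sampleVoteLogLik, logisticObjective, voteLogLik, linPred_eq_inner]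

variable (m : ℕ) (s : Fin 2 → ℕ) (y : EuclideanSpace ℝ (Fin p))

lemma gradient_voteLogLik (b : EuclideanSpace ℝ (Fin (p + 1))) :
    gradient (voteLogLik m s y) b = (s 0 - m * Real.sigmoid ⟪design y, b⟫) • design y := by
  refine HasGradientAt.gradient ?_
  rw [hasGradientAt_iff_hasFDerivAt]
  have hlin : HasFDerivAt (fun b => ⟪design y, b⟫) (innerSL ℝ (design y)) b :=
    (innerSL ℝ (design y)).hasFDerivAt
  have h1 := (hasDerivAt_softplus ⟪design y, b⟫).comp_hasFDerivAt b hlin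
  have h2 := (hlin.const_mul (s 0 : ℝ)).sub (h1.const_mul (m : ℝ))
  have h3 : voteLogLik m s y = fun b => (s 0 : ℝ) * ⟪design y, b⟫ -
      m * Real.log (1 + Real.exp ⟪design y, b⟫) := by
    ext b
    simp [voteLogLik, linPred_eq_inner]
  rw [h3]
  refine h2.congr_fderiv ?_
  ext v
  simp
  ring

lemma hessian_voteLogLik (b : EuclideanSpace ℝ (Fin (p + 1))) (i k : Fin (p + 1)) :
    hessian (voteLogLik m s y) b i k =
      -(m * (sigmoidSlope ⟪design y, b⟫ * (design y i * design y k))) := by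
  have hlin : HasFDerivAt (fun b => ⟪design y, b⟫) (innerSL ℝ (design y)) b :=
    (innerSL ℝ (design y)).hasFDerivAt
  have h1 := (hasDerivAt_sigmoid' ⟪design y, b⟫).comp_hasFDerivAt b hlin
  have h2 := ((h1.const_mul (m : ℝ)).const_sub (s 0 : ℝ)).smul_const (design y)
  have h3 : gradient (voteLogLik m s y) =
      fun b => ((s 0 : ℝ) - m * Real.sigmoid ⟪design y, b⟫) • design y :=
    funext (gradient_voteLogLik m s y)
  have h4 := h2.fderiv
  simp only [Function.comp_def] at h4
  rw [hessian, Matrix.of_apply, h3, h4]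
  simp [EuclideanSpace.inner_single_right]
  ring

end Score

/-! ### The information matrices -/

section Information

variable {Ω : Type*} [MeasurableSpace Ω] {μ : Measure Ω} {p : ℕ}

/-- The weighted second moment matrix of the regressors. -/
def designMoment (μ : Measure Ω) (Y : Ω → EuclideanSpace ℝ (Fin p))
    (β : EuclideanSpace ℝ (Fin (p + 1))) : Matrix (Fin (p + 1)) (Fin (p + 1)) ℝ :=
  Matrix.of fun i k =>
    ∫ ω, sigmoidSlope ⟪design (Y ω), β⟫ * (design (Y ω) i * design (Y ω) k) ∂μ

lemma inner_sq_eq_sum {ι : Type*} [Fintype ι] (x t : EuclideanSpace ℝ ι) :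
    ⟪x, t⟫ ^ 2 = ∑ i, ∑ k, t i * t k * (x i * x k) := by
  rw [sq, PiLp.inner_apply, Finset.sum_mul_sum]
  refine Finset.sum_congr rfl fun i _ => Finset.sum_congr rfl fun k _ => ?_
  simp
  ring

/-- Quadratic form of a weighted second moment matrix. -/
lemma integral_mul_inner_sq {ι : Type*} [Fintype ι] {X : Ω → EuclideanSpace ℝ ι} {w : Ω → ℝ}
    (h_int : ∀ i k, Integrable (fun ω => w ω * (X ω i * X ω k)) μ) {A : Matrix ι ι ℝ}
    (hA : ∀ i k, ∫ ω, w ω * (X ω i * X ω k) ∂μ = A i k) (t : EuclideanSpace ℝ ι) :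
    Integrable (fun ω => w ω * ⟪X ω, t⟫ ^ 2) μ ∧
      ∫ ω, w ω * ⟪X ω, t⟫ ^ 2 ∂μ = t ⬝ᵥ A.mulVec t := by
  have h1 : ∀ ω, w ω * ⟪X ω, t⟫ ^ 2 = ∑ i, ∑ k, t i * t k * (w ω * (X ω i * X ω k)) := by
    intro ω
    rw [inner_sq_eq_sum, Finset.mul_sum]
    refine Finset.sum_congr rfl fun i _ => ?_
    rw [Finset.mul_sum]
    exact Finset.sum_congr rfl fun k _ => by ring
  have h2 : ∀ i k, Integrable (fun ω => t i * t k * (w ω * (X ω i * X ω k))) μ :=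
    fun i k => (h_int i k).const_mul _
  simp only [h1]
  refine ⟨integrable_finsetSum _ fun i _ => integrable_finsetSum _ fun k _ => h2 i k, ?_⟩
  rw [integral_finsetSum _ fun i _ => integrable_finsetSum _ fun k _ => h2 i k]
  simp only [dotProduct, Matrix.mulVec, Finset.mul_sum]
  refine Finset.sum_congr rfl fun i _ => ?_
  rw [integral_finsetSum _ fun k _ => h2 i k]
  refine Finset.sum_congr rfl fun k _ => ?_
  rw [integral_const_mul, hA]
  ring

lemma sensitivity_eq (m : ℕ) (Y : Ω → EuclideanSpace ℝ (Fin p)) (S : Ω → Fin 2 → ℕ)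
    (β : EuclideanSpace ℝ (Fin (p + 1))) :
    sensitivity μ m Y S β = (m : ℝ) • designMoment μ Y β := by
  ext i k
  simp [sensitivity, hessian_voteLogLik, designMoment, integral_neg, integral_const_mul]

variable [IsProbabilityMeasure μ] {Y : Ω → EuclideanSpace ℝ (Fin p)}
  {β : EuclideanSpace ℝ (Fin (p + 1))}

/-- Quadratic form of the covariance matrix. -/
lemma dotProduct_covMatrix_mulVec (hY : MemLp Y 2 μ) (t : Fin p → ℝ) :
    t ⬝ᵥ (covMatrix μ Y).mulVec t = Var[fun ω => ∑ i, t i * Y ω i; μ] := by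
  have hc : ∀ i, MemLp (fun ω => t i * Y ω i) 2 μ := fun i => (hY.eval_piLp i).const_mul _
  rw [← covariance_self (memLp_finsetSum _ fun i _ => hc i).1.aemeasurable,
    covariance_fun_sum_fun_sum hc hc]
  simp only [dotProduct, Matrix.mulVec, Finset.mul_sum]
  refine Finset.sum_congr rfl fun i _ => Finset.sum_congr rfl fun k _ => ?_
  rw [covariance_const_mul_left, covariance_const_mul_right, covMatrix, Matrix.of_apply]
  ring

/-- The regressors are not concentrated on a hyperplane through the origin. -/
lemma eq_zero_of_inner_design_ae_eq_zero (hY : MemLp Y 2 μ) (hcov : (covMatrix μ Y).PosDef)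
    {t : EuclideanSpace ℝ (Fin (p + 1))} (ht : ∀ᵐ ω ∂μ, ⟪design (Y ω), t⟫ = 0) : t = 0 := by
  have hae : (fun ω => ∑ i, t (Fin.succ i) * Y ω i) =ᵐ[μ] fun _ => -t 0 := by
    filter_upwards [ht] with ω hω
    rw [← linPred_eq_inner, linPred] at hω
    linarith
  have hsucc : (fun i => t (Fin.succ i)) = 0 := by
    by_contra hne
    have h1 := hcov.dotProduct_mulVec_pos hne
    rw [star_trivial, dotProduct_covMatrix_mulVec hY, variance_congr hae] at h1
    simp [variance_eq_integral aemeasurable_const] at h1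
  have hzero : t 0 = 0 := by
    obtain ⟨ω, hω⟩ := hae.exists
    have : ∀ i, t (Fin.succ i) = 0 := fun i => congrFun hsucc i
    simp only [this, zero_mul, Finset.sum_const_zero] at hω
    linarith
  ext i
  refine Fin.cases hzero (fun i => congrFun hsucc i) i

lemma posDef_designMoment (hY : MemLp Y 2 μ) (hcov : (covMatrix μ Y).PosDef)
    (β : EuclideanSpace ℝ (Fin (p + 1))) : (designMoment μ Y β).PosDef := by
  refine Matrix.PosDef.of_dotProduct_mulVec_pos ?_ fun t ht => ?_
  · ext i k
    simp [designMoment, mul_comm]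
  · obtain ⟨h_int, heq⟩ := integral_mul_inner_sq
      (integrable_sigmoidSlope_mul (memLp_design hY) β) (A := designMoment μ Y β)
      (fun i k => rfl) (WithLp.toLp 2 t)
    rw [star_trivial]
    refine lt_of_lt_of_eq ?_ heq
    have hnn : 0 ≤ fun ω => sigmoidSlope ⟪design (Y ω), β⟫ *
        ⟪design (Y ω), WithLp.toLp 2 t⟫ ^ 2 :=
      fun ω => mul_nonneg (sigmoidSlope_pos _).le (sq_nonneg _)
    refine lt_of_le_of_ne (integral_nonneg hnn) fun h => ht ?_
    have h0 := (integral_eq_zero_iff_of_nonneg hnn h_int).1 h.symm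
    have := eq_zero_of_inner_design_ae_eq_zero hY hcov (t := WithLp.toLp 2 t) (by
      filter_upwards [h0] with ω hω
      have := (mul_eq_zero.1 hω).resolve_left (sigmoidSlope_pos _).ne'
      exact pow_eq_zero_iff two_ne_zero |>.1 this)
    simpa using this

/-- Moments of the logistic score of a response whose conditional mean is that of `m` logistic
trials and whose conditional variance is proportional to the logistic variance. -/
lemma score_moments (hYm : Measurable Y) (hY : MemLp Y 2 μ) {m : ℕ} {κ : ℝ} {W : Ω → Fin 2 → ℕ}
    (hW : Measurable W) {T : Finset (Fin 2 → ℕ)}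
    {q : (Fin 2 → ℕ) → EuclideanSpace ℝ (Fin p) → ℝ}
    (hlaw : ∀ s ∈ T, μ⟦W ⁻¹' {s} | MeasurableSpace.comap Y inferInstance⟧ =ᵐ[μ]
      fun ω => q s (Y ω)) (hT : ∀ s ∈ T, s 0 ≤ m)
    (hmom : ∀ y, ∑ s ∈ T, q s y = 1 ∧
      ∑ s ∈ T, (s 0 - m * Real.sigmoid ⟪design y, β⟫) * q s y = 0 ∧
      ∑ s ∈ T, (s 0 - m * Real.sigmoid ⟪design y, β⟫) ^ 2 * q s y =
        κ * sigmoidSlope ⟪design y, β⟫) :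
    MemLp (voteScore m Y W β) 2 μ ∧ ∫ ω, voteScore m Y W β ω ∂μ = 0 ∧
    (∀ i k, Integrable (fun ω => voteScore m Y W β ω i * voteScore m Y W β ω k) μ ∧
      ∫ ω, voteScore m Y W β ω i * voteScore m Y W β ω k ∂μ = κ * designMoment μ Y β i k) ∧
    covMatrix μ (voteScore m Y W β) = κ • designMoment μ Y β := by
  have hscore : voteScore m Y W β =
      fun ω => ((W ω 0 : ℝ) - m * Real.sigmoid ⟪design (Y ω), β⟫) • design (Y ω) :=
    funext fun ω => gradient_voteLogLik m (W ω) (Y ω) β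
  have hD := memLp_design hY
  have hDc : ∀ i, MemLp (fun ω => design (Y ω) i) 2 μ := fun i => hD.eval_piLp i
  have hsig : Measurable fun y : EuclideanSpace ℝ (Fin p) => Real.sigmoid ⟪design y, β⟫ :=
    continuous_sigmoid.measurable.comp (measurable_design.inner_const)
  have hdm : ∀ i, Measurable fun y : EuclideanSpace ℝ (Fin p) => design y i := fun i =>
    (EuclideanSpace.proj (𝕜 := ℝ) i).continuous.measurable.comp measurable_design
  have hres : ∀ s : Fin 2 → ℕ, Measurable fun y : EuclideanSpace ℝ (Fin p) =>
      (s 0 : ℝ) - m * Real.sigmoid ⟪design y, β⟫ := fun s => (hsig.const_mul _).const_sub _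
  have hbound : ∀ s ∈ T, ∀ y, |(s 0 : ℝ) - m * Real.sigmoid ⟪design y, β⟫| ≤ m := by
    intro s hs y
    have h1 : (s 0 : ℝ) ≤ m := by exact_mod_cast hT s hs
    have h2 : (0 : ℝ) ≤ s 0 := Nat.cast_nonneg _
    have h3 := mul_le_of_le_one_right (Nat.cast_nonneg (α := ℝ) m)
      (Real.sigmoid_le_one ⟪design y, β⟫)
    have h4 := mul_nonneg (Nat.cast_nonneg (α := ℝ) m) (Real.sigmoid_nonneg ⟪design y, β⟫)
    rw [abs_le]
    constructor <;> linarith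
  have hmem := ae_mem_of_condProb hYm hW hlaw fun y => (hmom y).1
  have hL : MemLp (voteScore m Y W β) 2 μ := by
    rw [hscore]
    refine hD.of_le_mul (c := m) ?_ ?_
    · refine AEMeasurable.aestronglyMeasurable (Measurable.aemeasurable ?_)
      have hW0 : Measurable fun ω => (W ω 0 : ℝ) :=
        measurable_from_top.comp ((measurable_pi_apply 0).comp hW)
      exact (hW0.sub ((hsig.comp hYm).const_mul _)).smul (measurable_design.comp hYm)
    · filter_upwards [hmem] with ω hω
      rw [norm_smul]
      exact mul_le_mul_of_nonneg_right (hbound _ hω _) (norm_nonneg _)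
  have hcoord0 : ∀ i, ∫ ω, voteScore m Y W β ω i ∂μ = 0 := by
    intro i
    have h1 := integral_response_eq hYm hW hlaw (fun y => (hmom y).1)
      (g := fun s y => (s 0 - m * Real.sigmoid ⟪design y, β⟫) * design y i)
      (fun s _ => (hres s).mul (hdm i)) (fun s hs =>
        ((hDc i).integrable (by norm_num)).bdd_mul (c := m)
          ((hres s).comp hYm).aestronglyMeasurable (ae_of_all _ fun ω => hbound s hs _))
    have h2 : ∀ y, ∑ s ∈ T, (s 0 - m * Real.sigmoid ⟪design y, β⟫) * design y i * q s y = 0 := by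
      intro y
      rw [← mul_zero (design y i), ← (hmom y).2.1, Finset.mul_sum]
      exact Finset.sum_congr rfl fun s _ => by ring
    simp only [h2, integral_zero] at h1
    rw [hscore]
    simpa using h1
  have hsecond : ∀ i k, ∫ ω, voteScore m Y W β ω i * voteScore m Y W β ω k ∂μ =
      κ * designMoment μ Y β i k := by
    intro i k
    have h1 := integral_response_eq hYm hW hlaw (fun y => (hmom y).1)
      (g := fun s y => (s 0 - m * Real.sigmoid ⟪design y, β⟫) ^ 2 * (design y i * design y k))
      (fun s _ => ((hres s).pow_const 2).mul ((hdm i).mul (hdm k))) (fun s hs =>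
        (MemLp.integrable_mul (hDc i) (hDc k)).bdd_mul (c := (m : ℝ) ^ 2)
          (((hres s).pow_const 2).comp hYm).aestronglyMeasurable (ae_of_all _ fun ω => by
            rw [Real.norm_eq_abs, abs_pow]
            exact pow_le_pow_left₀ (abs_nonneg _) (hbound s hs _) 2))
    have h2 : ∀ y, ∑ s ∈ T, (s 0 - m * Real.sigmoid ⟪design y, β⟫) ^ 2 *
        (design y i * design y k) * q s y =
        κ * (sigmoidSlope ⟪design y, β⟫ * (design y i * design y k)) := by
      intro y
      rw [← mul_assoc, ← (hmom y).2.2, Finset.sum_mul]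
      exact Finset.sum_congr rfl fun s _ => by ring
    simp only [h2] at h1
    rw [integral_const_mul] at h1
    rw [designMoment, Matrix.of_apply, ← h1, hscore]
    refine integral_congr_ae (ae_of_all _ fun ω => ?_)
    simp
    ring
  refine ⟨hL, ?_, fun i k => ⟨MemLp.integrable_mul (hL.eval_piLp i) (hL.eval_piLp k),
    hsecond i k⟩, ?_⟩
  · ext i
    have h1 := (EuclideanSpace.proj (𝕜 := ℝ) i).integral_comp_comm
      (hL.integrable (by norm_num))
    exact h1.symm.trans (hcoord0 i)
  · ext i k
    rw [covMatrix, Matrix.of_apply, covariance, hcoord0, hcoord0]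
    simp only [sub_zero]
    rw [hsecond, Matrix.smul_apply, smul_eq_mul]

lemma smul_mul_smul_inv_mul_smul {n : Type*} [Fintype n] [DecidableEq n] {A : Matrix n n ℝ}
    (hA : IsUnit A.det) (m κ : ℝ) (hκ : κ ≠ 0) :
    (m • A) * (κ • A)⁻¹ * (m • A) = (m ^ 2 / κ) • A := by
  have h : (κ • A)⁻¹ = κ⁻¹ • A⁻¹ := by
    refine Matrix.inv_eq_right_inv ?_
    rw [Matrix.smul_mul, Matrix.mul_smul, smul_smul, mul_inv_cancel₀ hκ, one_smul,
      Matrix.mul_nonsing_inv _ hA]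
  rw [h]
  simp only [Matrix.smul_mul, Matrix.mul_smul, Matrix.mul_nonsing_inv _ hA, Matrix.one_mul,
    smul_smul]
  congr 1
  field_simp

end Information

end NoisyLabels

end

open NoisyLabels

theorem theorem1 {Ω : Type*} [MeasurableSpace Ω] (μ : Measure Ω) [IsProbabilityMeasure μ]
    {p : ℕ} (m : ℕ) (hm : 1 ≤ m) (α₀ : ℝ) (hα₀ : 0 < α₀)
    (β : EuclideanSpace ℝ (Fin (p + 1)))
    (Y : ℕ → Ω → EuclideanSpace ℝ (Fin p)) (Z S : ℕ → Ω → Fin 2 → ℕ)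
    (hmodel : NoisyLabels.IsNoisyLabelModel μ m α₀ β Y Z S)
    (βM : ℕ → Ω → EuclideanSpace ℝ (Fin (p + 1)))
    (hβM_meas : ∀ n, AEMeasurable (βM n) μ)
    (hβM_max : ∀ n, ∀ᵐ ω ∂μ,
      (∃ b, NoisyLabels.IsVoteMaximiser m n (fun j => S j ω) (fun j => Y j ω) b) →
        NoisyLabels.IsVoteMaximiser m n (fun j => S j ω) (fun j => Y j ω) (βM n ω)) :
    -- the maximiser exists with probability tending to one
    Tendsto (fun n : ℕ => μ {ω | ¬ ∃ b,
      NoisyLabels.IsVoteMaximiser m n (fun j => S j ω) (fun j => Y j ω) b}) atTop (𝓝 0) ∧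
    -- consistency
    TendstoInMeasure μ βM atTop (fun _ => β) ∧
    -- the moments that define the information matrices exist
    MemLp (NoisyLabels.labelScore (Y 0) (Z 0) β) 2 μ ∧
    MemLp (NoisyLabels.voteScore m (Y 0) (S 0) β) 2 μ ∧
    (∀ i k, Integrable
      (fun ω => NoisyLabels.hessian (NoisyLabels.voteLogLik m (S 0 ω) (Y 0 ω)) β i k) μ) ∧
    -- the information matrices are nondegenerate
    (NoisyLabels.fisherInfo μ (Y 0) (Z 0) β).PosDef ∧
    (NoisyLabels.variability μ m (Y 0) (S 0) β).PosDef ∧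
    -- asymptotic normality
    TendstoInDistribution (fun (n : ℕ) ω => √(n : ℝ) • (βM n ω - β)) atTop id (fun _ => μ)
      (multivariateGaussian 0 (NoisyLabels.godambeInfo μ m (Y 0) (S 0) β)⁻¹) ∧
    -- the Godambe information
    NoisyLabels.godambeInfo μ m (Y 0) (S 0) β =
      (m * (1 + α₀) / (m + α₀)) • NoisyLabels.fisherInfo μ (Y 0) (Z 0) β := by
  have hm0 : (0 : ℝ) < m := by exact_mod_cast hm
  set A := designMoment μ (Y 0) β with hAdef
  set κ : ℝ := m * (m + α₀) / (1 + α₀) with hκdef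
  have hκ : 0 < κ := by positivity
  have hA : A.PosDef := posDef_designMoment (hmodel.memLp_Y 0) (hmodel.posDef_cov 0) β
  have hdet : IsUnit A.det := hA.det_pos.ne'.isUnit
  obtain ⟨hSL, hS0, hSsecond, hScov⟩ := score_moments (β := β) (κ := κ) (m := m)
    (T := countVectors m) (hmodel.measurable_Y 0) (hmodel.memLp_Y 0) (hmodel.measurable_S 0)
    (q := fun s y => dirichletMultinomialPMF m (fun i => α₀ * classProb β y i) s)
    (fun s _ => hmodel.vote_law 0 s) (fun s hs => apply_zero_le_of_mem_countVectors hs)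
    (fun y => dirichletMultinomialPMF_moments m hα₀ (Real.sigmoid_pos _) (Real.sigmoid_lt_one _)
      (by rw [classProb_zero]) (by rw [classProb_one]))
  have hlabel : labelScore (Y 0) (Z 0) β = voteScore 1 (Y 0) (Z 0) β :=
    funext fun ω => by rw [labelScore, voteScore, labelLogLik_eq_voteLogLik]
  have hne : (Pi.single 0 1 : Fin 2 → ℕ) ≠ Pi.single 1 1 := fun h => by simpa using congrFun h 0
  obtain ⟨hZL, -, -, hZcov⟩ := score_moments (β := β) (κ := 1) (m := 1)
    (T := {Pi.single 0 1, Pi.single 1 1}) (hmodel.measurable_Y 0) (hmodel.memLp_Y 0)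
    (hmodel.measurable_Z 0)
    (q := fun s y => if s = Pi.single 0 1 then classProb β y 0 else classProb β y 1)
    (by
      intro s hs
      rcases Finset.mem_insert.1 hs with rfl | hs
      · simpa using hmodel.label_law 0 0
      · rw [Finset.mem_singleton.1 hs]
        simpa [hne.symm] using hmodel.label_law 0 1)
    (by
      intro s hs
      rcases Finset.mem_insert.1 hs with rfl | hs
      · simp
      · rw [Finset.mem_singleton.1 hs]
        simp)
    (fun y => by
      simp only [Finset.sum_pair hne, if_true, if_neg hne.symm, classProb_zero, classProb_one,
        sigmoidSlope]
      refine ⟨by ring, ?_, ?_⟩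
      · simp
        ring
      · simp
        ring)
  have hfisher : fisherInfo μ (Y 0) (Z 0) β = A := by
    rw [fisherInfo, hlabel, hZcov, one_smul]
  have hvariab : variability μ m (Y 0) (S 0) β = κ • A := hScov
  have hgodambe : godambeInfo μ m (Y 0) (S 0) β = ((m : ℝ) ^ 2 / κ) • A := by
    rw [godambeInfo, sensitivity_eq, hvariab, smul_mul_smul_inv_mul_smul hdet _ _ hκ.ne']
  have hginv : (godambeInfo μ m (Y 0) (S 0) β)⁻¹ = (κ / (m : ℝ) ^ 2) • A⁻¹ := by
    rw [hgodambe]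
    refine Matrix.inv_eq_right_inv ?_
    rw [Matrix.smul_mul, Matrix.mul_smul, smul_smul, Matrix.mul_nonsing_inv _ hdet,
      div_mul_div_cancel₀ hκ.ne', div_self (by positivity), one_smul]
  have hscore : ∀ ω, voteScore m (Y 0) (S 0) β ω =
      ((S 0 ω 0 : ℝ) - m * Real.sigmoid ⟪design (Y 0 ω), β⟫) • design (Y 0 ω) :=
    fun ω => gradient_voteLogLik m (S 0 ω) (Y 0 ω) β
  have hpair : Measurable fun d : EuclideanSpace ℝ (Fin p) × (Fin 2 → ℕ) × (Fin 2 → ℕ) =>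
      (design d.1, (d.2.2 0 : ℝ)) :=
    (measurable_design.comp measurable_fst).prodMk (measurable_from_top.comp
      ((measurable_pi_apply 0).comp (measurable_snd.comp measurable_snd)))
  have hmaxiff : ∀ n ω b, IsVoteMaximiser m n (fun j => S j ω) (fun j => Y j ω) b ↔
      ∀ b', logisticObjective (m : ℝ) n (fun j => (S j ω 0 : ℝ)) (fun j => design (Y j ω)) b' ≤
        logisticObjective (m : ℝ) n (fun j => (S j ω 0 : ℝ)) (fun j => design (Y j ω)) b := by
    intro n ω b
    simp only [IsVoteMaximiser, sampleVoteLogLik_eq_logisticObjective]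
  simp only [hmaxiff] at hβM_max ⊢
  obtain ⟨hexists, hnormal⟩ := logisticObjective_asymptotics (A := A) (β := β) (κ := κ)
    (X := fun j ω => design (Y j ω)) (s := fun j ω => (S j ω 0 : ℝ)) hm0
    (hmodel.indep.comp (fun _ d => (design d.1, (d.2.2 0 : ℝ))) fun _ => hpair)
    (fun j => (hmodel.identDistrib j).comp hpair) (memLp_design (hmodel.memLp_Y 0))
    (fun i k => rfl) hA (by simpa only [← hscore] using hSL) (by simpa only [← hscore] using hS0)
    hκ.le
    (by
      intro t
      simp only [← hscore]
      have h1 := (integral_mul_inner_sq (w := fun _ => 1) (A := κ • A)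
        (fun i k => by simpa only [one_mul] using (hSsecond i k).1)
        (fun i k => by simpa only [one_mul, Matrix.smul_apply, smul_eq_mul] using (hSsecond i k).2) t).2
      simpa only [one_mul, Matrix.smul_mulVec, dotProduct_smul, smul_eq_mul] using h1)
    hβM_meas hβM_max
  refine ⟨hexists, tendstoInMeasure_of_sqrt_smul_tendstoInDistribution hnormal, hlabel ▸ hZL, hSL,
    fun i k => ?_, hfisher ▸ hA, hvariab ▸ hA.smul hκ, hginv ▸ hnormal, ?_⟩
  · simp only [hessian_voteLogLik]
    exact ((integrable_sigmoidSlope_mul (memLp_design (hmodel.memLp_Y 0)) β i k).const_mul _).neg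
  · rw [hgodambe, hfisher, hκdef]
    congr 1
    field_simp
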